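/- Work over $\mathbb{C}$. For integers $n,\ell\ge 0$ put $V=\mathbb{C}^n$, $G=GL(V)$, $\overline{R}=\mathfrak{sl}(V)^{\oplus \ell}\oplus V^*$, and identify, by the trace form, $T^*\overline{R}=\mathfrak{sl}(V)^{\oplus 2\ell}\oplus V^*\oplus V\ni (X_1,\dots,X_\ell,Y_1,\dots,Y_\ell,i,j)$, where $g\in G$ acts by $(gX_kg^{-1},gY_kg^{-1},ig^{-1},gj)$. Let $\mu(X,Y,i,j)=\sum_{k=1}^{\ell}[X_k,Y_k]-ji\in\mathfrak{gl}(V)$ be the moment map, let $\theta=\det^{-1}$, and let $\overline{\mathcal{M}}^{\theta}(n,\ell)=\mu^{-1}(0)^{\theta\text{-}ss}/\!/^{\theta}G$ be the GIT quotient; here a point is $\theta$-semistable if, for some $m>0$, some function $f\in\mathbb{C}[\mu^{-1}(0)]$ with $f(g^{-1}x)=\theta(g)^m f(x)$ for all $g\in G$, $x\in\mu^{-1}(0)$ does not vanish at it. The torus $T=(\mathbb{C}^*)^\ell$ acts on $T^*\overline{R}$ by $(t_1,\dots,t_\ell)\cdot(X,Y,i,j)=(t_1X_1,\dots,t_\ell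 X_\ell,t_1^{-1}Y_1,\dots,t_\ell^{-1}Y_\ell,i,j)$, and this action descends to $\overline{\mathcal{M}}^{\theta}(n,\ell)$. Theorem. Let $\ell\ge 1$ and $d\ge 1$ be integers and let $\tilde\nu:\mathbb{C}^*\to T$, $\tilde\nu(t)=(t^d,1,\dots,1)$. Then the fixed locus $\overline{\mathcal{M}}^{\theta}(2,\ell)^{\tilde\nu(\mathbb{C}^*)}$, as a (reduced) subvariety of $\overline{\mathcal{M}}^{\theta}(2,\ell)$, is isomorphic, as an algebraic variety, to the disjoint union $$\overline{\mathcal{M}}^{\theta}(2,\ell-1)\;\sqcup\;\mathbb{C}^{2\ell-2}\;\sqcup\;\mathbb{C}^{2\ell-2}.$$ -/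

import Mathlib

open Topology

noncomputable section

/-! ### Complex varieties as spaces with functions -/

/-- A topological space together with a sheaf of `ℂ`-algebras of `ℂ`-valued functions.
The sheaf is recorded by the predicate "`f` is regular in a neighbourhood of `x`":
the sections over an open set `U` are the functions on `U` that are regular at all points of `U`
(for a function on `U`, extended to the whole space in any way, this does not depend on the
extension, by `germ`).  Classical complex algebraic varieties with their Zariski topology and their
regular functions are spaces of this kind, and they form a full subcategory. -/
structure FunctionSpace where
  carrier : Type
  top : TopologicalSpace carrier
  RegularAt : (carrier → ℂ) → carrier → Prop
  germ : ∀ {f g : carrier → ℂ} {x : carrier},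
    (∀ᶠ y in 𝓝 x, f y = g y) → RegularAt f x → RegularAt g x
  nearby : ∀ {f : carrier → ℂ} {x : carrier}, RegularAt f x → ∀ᶠ y in 𝓝 x, RegularAt f y
  const : ∀ (c : ℂ) (x : carrier), RegularAt (fun _ => c) x
  add : ∀ {f g : carrier → ℂ} {x : carrier},
    RegularAt f x → RegularAt g x → RegularAt (fun y => f y + g y) x
  mul : ∀ {f g : carrier → ℂ} {x : carrier},
    RegularAt f x → RegularAt g x → RegularAt (fun y => f y * g y) x

namespace FunctionSpace

instance (X : FunctionSpace) : TopologicalSpace X.carrier := X.top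

/-- An isomorphism: a homeomorphism that identifies the sheaves of regular functions. -/
structure Iso (X Y : FunctionSpace) where
  toHomeomorph : X.carrier ≃ₜ Y.carrier
  regularAt_iff : ∀ (f : Y.carrier → ℂ) (x : X.carrier),
    X.RegularAt (fun z => f (toHomeomorph z)) x ↔ Y.RegularAt f (toHomeomorph x)

/-- The structure induced on a subset `S`: the subspace topology, and the functions that are
locally restrictions of regular functions.  For a closed subset of a variety this is the structure
of a reduced closed subvariety, for an open subset that of an open subvariety. -/
def induced (X : FunctionSpace) (S : Set X.carrier) : FunctionSpace where
  carrier := S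
  top := inferInstance
  RegularAt f x := ∃ g : X.carrier → ℂ, X.RegularAt g x ∧ ∀ᶠ y : S in 𝓝 x, g y = f y
  germ := by
    rintro f g x h ⟨k, hk, hkf⟩
    refine ⟨k, hk, ?_⟩
    filter_upwards [h, hkf] with y h1 h2 using h2.trans h1
  nearby := by
    rintro f x ⟨k, hk, hkf⟩
    have h1 : ∀ᶠ y : S in 𝓝 x, X.RegularAt k y :=
      continuous_subtype_val.continuousAt.eventually (X.nearby hk)
    filter_upwards [h1, hkf.eventually_nhds] with y h1 h2 using ⟨k, h1, h2⟩
  const c x := ⟨fun _ => c, X.const c x, Filter.Eventually.of_forall fun _ => rfl⟩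
  add := by
    rintro f g x ⟨k, hk, hkf⟩ ⟨l, hl, hlg⟩
    refine ⟨_, X.add hk hl, ?_⟩
    filter_upwards [hkf, hlg] with y h1 h2
    rw [h1, h2]
  mul := by
    rintro f g x ⟨k, hk, hkf⟩ ⟨l, hl, hlg⟩
    refine ⟨_, X.mul hk hl, ?_⟩
    filter_upwards [hkf, hlg] with y h1 h2
    rw [h1, h2]

/-- The quotient by (the equivalence relation generated by) `r`: the quotient topology, and the
functions whose pullback is regular. -/
def quotient (X : FunctionSpace) (r : X.carrier → X.carrier → Prop) : FunctionSpace where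
  carrier := Quot r
  top := inferInstance
  RegularAt f p := ∀ᶠ q in 𝓝 p, ∀ x : X.carrier, Quot.mk r x = q →
    X.RegularAt (fun y => f (Quot.mk r y)) x
  germ := by
    intro f g p h hf
    filter_upwards [h.eventually_nhds, hf] with q h1 h2 x hx
    subst hx
    exact X.germ (continuous_quot_mk.continuousAt.eventually h1) (h2 x rfl)
  nearby := fun h => h.eventually_nhds
  const c p := Filter.Eventually.of_forall fun _ x _ => X.const c x
  add := by
    intro f g p hf hg
    filter_upwards [hf, hg] with q h1 h2 x hx using X.add (h1 x hx) (h2 x hx)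
  mul := by
    intro f g p hf hg
    filter_upwards [hf, hg] with q h1 h2 x hx using X.mul (h1 x hx) (h2 x hx)

/-- The disjoint union. -/
def coprod (X Y : FunctionSpace) : FunctionSpace where
  carrier := X.carrier ⊕ Y.carrier
  top := inferInstance
  RegularAt f p := match p with
    | .inl x => X.RegularAt (fun z => f (.inl z)) x
    | .inr y => Y.RegularAt (fun z => f (.inr z)) y
  germ := by
    rintro f g (x | y) h hf
    · exact X.germ (continuous_inl.continuousAt.eventually h) hf
    · exact Y.germ (continuous_inr.continuousAt.eventually h) hf
  nearby := by
    rintro f (x | y) hf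
    · rw [nhds_inl, Filter.eventually_map]
      exact X.nearby hf
    · rw [nhds_inr, Filter.eventually_map]
      exact Y.nearby hf
  const := by
    rintro c (x | y)
    · exact X.const c x
    · exact Y.const c y
  add := by
    rintro f g (x | y) hf hg
    · exact X.add hf hg
    · exact Y.add hf hg
  mul := by
    rintro f g (x | y) hf hg
    · exact X.mul hf hg
    · exact Y.mul hf hg

end FunctionSpace

/-! ### Vector spaces as affine varieties -/

section Affine

variable (W : Type) [AddCommGroup W] [Module ℂ W]

/-- The algebra of polynomial functions on a complex vector space, generated by the linear forms. -/
def polyFun : Subalgebra ℂ (W → ℂ) :=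
  Algebra.adjoin ℂ {f : W → ℂ | ∃ φ : Module.Dual ℂ W, f = fun w => φ w}

/-- The Zariski topology: the sets `{q ≠ 0}`, for `q` a polynomial function, form a basis. -/
@[reducible] def zariskiTopology : TopologicalSpace W :=
  TopologicalSpace.generateFrom {U : Set W | ∃ q ∈ polyFun W, U = {w | q w ≠ 0}}

theorem isTopologicalBasis_zariski :
    @TopologicalSpace.IsTopologicalBasis W (zariskiTopology W)
      {U : Set W | ∃ q ∈ polyFun W, U = {w | q w ≠ 0}} := by
  let _ := zariskiTopology W
  refine ⟨?_, ?_, rfl⟩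
  · rintro _ ⟨p, hp, rfl⟩ _ ⟨q, hq, rfl⟩ x hx
    refine ⟨_, ⟨p * q, mul_mem hp hq, rfl⟩, ?_, ?_⟩
    · exact mul_ne_zero hx.1 hx.2
    · intro y hy
      exact ⟨left_ne_zero_of_mul hy, right_ne_zero_of_mul hy⟩
  · refine Set.eq_univ_of_forall fun x => ?_
    exact Set.mem_sUnion.2 ⟨_, ⟨1, one_mem _, rfl⟩, one_ne_zero⟩

/-- A complex vector space as an affine variety: near `x`, a regular function is a quotient `p / q`
of polynomial functions with `q x ≠ 0`. -/
def affineSpace : FunctionSpace where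
  carrier := W
  top := zariskiTopology W
  RegularAt f x := ∃ p ∈ polyFun W, ∃ q ∈ polyFun W, q x ≠ 0 ∧ ∀ y, q y ≠ 0 → f y = p y / q y
  germ := by
    rintro f g x h ⟨p, hp, q, hq, hx, hf⟩
    let _ := zariskiTopology W
    obtain ⟨_, ⟨s, hs, rfl⟩, hsx, hsub⟩ :=
      (isTopologicalBasis_zariski W).mem_nhds_iff.1 h
    refine ⟨p * s, mul_mem hp hs, q * s, mul_mem hq hs, mul_ne_zero hx hsx, fun y hy => ?_⟩
    have hqy : q y ≠ 0 := left_ne_zero_of_mul hy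
    have hsy : s y ≠ 0 := right_ne_zero_of_mul hy
    have : f y = g y := hsub hsy
    rw [← this, hf y hqy]
    exact (mul_div_mul_right _ _ hsy).symm
  nearby := by
    rintro f x ⟨p, hp, q, hq, hx, hf⟩
    let _ := zariskiTopology W
    refine (isTopologicalBasis_zariski W).mem_nhds_iff.2
      ⟨_, ⟨q, hq, rfl⟩, hx, fun y hy => ⟨p, hp, q, hq, hy, hf⟩⟩
  const c x := ⟨algebraMap ℂ _ c, Subalgebra.algebraMap_mem _ c, 1, one_mem _, one_ne_zero,
    fun y _ => (div_one c).symm⟩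
  add := by
    rintro f g x ⟨p, hp, q, hq, hx, hf⟩ ⟨p', hp', q', hq', hx', hg⟩
    refine ⟨p * q' + q * p', add_mem (mul_mem hp hq') (mul_mem hq hp'), q * q', mul_mem hq hq',
      mul_ne_zero hx hx', fun y hy => ?_⟩
    have h1 : q y ≠ 0 := left_ne_zero_of_mul hy
    have h2 : q' y ≠ 0 := right_ne_zero_of_mul hy
    show f y + g y = _
    rw [hf y h1, hg y h2]
    exact div_add_div _ _ h1 h2
  mul := by
    rintro f g x ⟨p, hp, q, hq, hx, hf⟩ ⟨p', hp', q', hq', hx', hg⟩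
    refine ⟨p * p', mul_mem hp hp', q * q', mul_mem hq hq',
      mul_ne_zero hx hx', fun y hy => ?_⟩
    have h1 : q y ≠ 0 := left_ne_zero_of_mul hy
    have h2 : q' y ≠ 0 := right_ne_zero_of_mul hy
    show f y * g y = _
    rw [hf y h1, hg y h2]
    exact div_mul_div_comm _ _ _ _

end Affine

theorem polyFun_comp {W W' : Type} [AddCommGroup W] [Module ℂ W] [AddCommGroup W'] [Module ℂ W']
    (a : W →ₗ[ℂ] W') {f : W' → ℂ} (hf : f ∈ polyFun W') : (fun w => f (a w)) ∈ polyFun W := by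
  induction hf using Algebra.adjoin_induction with
  | mem f hf =>
    obtain ⟨φ, rfl⟩ := hf
    exact Algebra.subset_adjoin ⟨φ.comp a, rfl⟩
  | algebraMap c => exact Subalgebra.algebraMap_mem _ c
  | add f g _ _ h1 h2 => exact add_mem h1 h2
  | mul f g _ _ h1 h2 => exact mul_mem h1 h2

theorem continuous_zariski_linear {W : Type} [AddCommGroup W] [Module ℂ W] (a : W →ₗ[ℂ] W) :
    Continuous[zariskiTopology W, zariskiTopology W] a := by
  let _ := zariskiTopology W
  refine (isTopologicalBasis_zariski W).continuous_iff.2 ?_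
  rintro _ ⟨q, hq, rfl⟩
  exact (isTopologicalBasis_zariski W).isOpen ⟨_, polyFun_comp a hq, rfl⟩

/-! ### GIT quotients -/

section GIT

variable {G T W : Type} [Group G] [Group T] [AddCommGroup W] [Module ℂ W]

/-- The `θ`-semistable points of a closed `G`-stable subset `Z` of a representation: some function
`f` on `Z` in the weight space `ℂ[Z]^{G, θ ^ m}` with `m > 0`, for the action
`(g • f) z = f (g⁻¹ z)`, does not vanish there. -/
def semistable (ρ : Representation ℂ G W) (θ : G →* ℂˣ) (Z : Set W) : Set W :=
  {x | x ∈ Z ∧ ∃ m : ℕ, 0 < m ∧ ∃ f ∈ polyFun W,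
    (∀ g : G, ∀ z ∈ Z, f (ρ g⁻¹ z) = ((θ g : ℂˣ) : ℂ) ^ m * f z) ∧ f x ≠ 0}

/-- The semistable locus with its variety structure. -/
def semistableSpace (ρ : Representation ℂ G W) (θ : G →* ℂˣ) (Z : Set W) : FunctionSpace :=
  FunctionSpace.induced (affineSpace W) (semistable ρ θ Z : Set W)

/-- The `G`-orbit of a semistable point. -/
def semistableOrbit (ρ : Representation ℂ G W) (θ : G →* ℂˣ) (Z : Set W)
    (x : (semistableSpace ρ θ Z).carrier) : Set (semistableSpace ρ θ Z).carrier :=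
  {y | ∃ g : G, (y.1 : W) = ρ g (x.1 : W)}

/-- Two semistable points have the same image in the GIT quotient when the closures of their
orbits in the semistable locus intersect. -/
def orbitClosuresMeet (ρ : Representation ℂ G W) (θ : G →* ℂˣ) (Z : Set W)
    (x y : (semistableSpace ρ θ Z).carrier) : Prop :=
  (closure (semistableOrbit ρ θ Z x) ∩ closure (semistableOrbit ρ θ Z y)).Nonempty

/-- The GIT quotient `Z^{θ-ss} //^θ G`: its points are the semistable points up to the relation
above, its topology is the quotient topology, and its regular functions are the invariant regular
functions upstairs. -/
def gitQuotient (ρ : Representation ℂ G W) (θ : G →* ℂˣ) (Z : Set W) : FunctionSpace :=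
  (semistableSpace ρ θ Z).quotient (orbitClosuresMeet ρ θ Z)

variable (ρ : Representation ℂ G W) (θ : G →* ℂˣ) (Z : Set W) (τ : Representation ℂ T W)

theorem semistable_map (hcomm : ∀ t g w, τ t (ρ g w) = ρ g (τ t w))
    (hZ : ∀ t, ∀ z ∈ Z, τ t z ∈ Z) (t : T) {x : W} (hx : x ∈ semistable ρ θ Z) :
    τ t x ∈ semistable ρ θ Z := by
  obtain ⟨hxZ, m, hm, f, hf, hinv, hfx⟩ := hx
  refine ⟨hZ t x hxZ, m, hm, fun w => f (τ t⁻¹ w), polyFun_comp _ hf, fun g z hz => ?_, ?_⟩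
  · show f (τ t⁻¹ (ρ g⁻¹ z)) = _
    rw [hcomm]
    exact hinv g _ (hZ _ _ hz)
  · show f (τ t⁻¹ (τ t x)) ≠ 0
    simpa using hfx

/-- A linear action commuting with `G` and preserving `Z`, on the semistable locus. -/
def semistableAct (hcomm : ∀ t g w, τ t (ρ g w) = ρ g (τ t w))
    (hZ : ∀ t, ∀ z ∈ Z, τ t z ∈ Z) (t : T) (x : (semistableSpace ρ θ Z).carrier) :
    (semistableSpace ρ θ Z).carrier :=
  ⟨τ t x.1, semistable_map ρ θ Z τ hcomm hZ t x.2⟩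

theorem continuous_semistableAct (hcomm : ∀ t g w, τ t (ρ g w) = ρ g (τ t w))
    (hZ : ∀ t, ∀ z ∈ Z, τ t z ∈ Z) (t : T) :
    Continuous (semistableAct ρ θ Z τ hcomm hZ t) := by
  let _ := zariskiTopology W
  exact Continuous.subtype_mk ((continuous_zariski_linear (τ t)).comp continuous_subtype_val) _

theorem semistableAct_closure (hcomm : ∀ t g w, τ t (ρ g w) = ρ g (τ t w))
    (hZ : ∀ t, ∀ z ∈ Z, τ t z ∈ Z) (t : T) {x z : (semistableSpace ρ θ Z).carrier}
    (hz : z ∈ closure (semistableOrbit ρ θ Z x)) :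
    semistableAct ρ θ Z τ hcomm hZ t z ∈
      closure (semistableOrbit ρ θ Z (semistableAct ρ θ Z τ hcomm hZ t x)) := by
  refine map_mem_closure (continuous_semistableAct ρ θ Z τ hcomm hZ t) hz ?_
  rintro y ⟨g, hg⟩
  refine ⟨g, ?_⟩
  show τ t y.1 = ρ g (τ t x.1)
  exact (congrArg (τ t) hg).trans (hcomm t g x.1)

/-- A linear action commuting with `G` and preserving `Z` descends to the GIT quotient. -/
def gitAct (hcomm : ∀ t g w, τ t (ρ g w) = ρ g (τ t w))
    (hZ : ∀ t, ∀ z ∈ Z, τ t z ∈ Z) (t : T) :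
    (gitQuotient ρ θ Z).carrier → (gitQuotient ρ θ Z).carrier :=
  Quot.map (semistableAct ρ θ Z τ hcomm hZ t) fun _ _ ⟨z, hx, hy⟩ =>
    ⟨semistableAct ρ θ Z τ hcomm hZ t z, semistableAct_closure ρ θ Z τ hcomm hZ t hx,
      semistableAct_closure ρ θ Z τ hcomm hZ t hy⟩

end GIT

/-! ### The quiver variety -/

open LieAlgebra.SpecialLinear in
/-- The space `𝔰𝔩(V)^ℓ ⊕ 𝔰𝔩(V)^ℓ ⊕ V^* ⊕ V` with `V = ℂⁿ`, which is the cotangent bundle of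
`𝔰𝔩(V)^ℓ ⊕ V^*` via the trace form.  Its points are the tuples `(X, Y, i, j)`, with `i` a row
vector and `j` a column vector. -/
abbrev QuiverRep (n ℓ : ℕ) : Type :=
  (Fin ℓ → sl (Fin n) ℂ) × (Fin ℓ → sl (Fin n) ℂ) × (Fin n → ℂ) × (Fin n → ℂ)

/-- Conjugation `A ↦ g A g⁻¹` on traceless matrices. -/
def slConj {n : ℕ} (g : GL (Fin n) ℂ) :
    LieAlgebra.SpecialLinear.sl (Fin n) ℂ →ₗ[ℂ] LieAlgebra.SpecialLinear.sl (Fin n) ℂ where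
  toFun A := ⟨(g : Matrix (Fin n) (Fin n) ℂ) * A.1 * (g⁻¹ : GL (Fin n) ℂ).1, by
    have h : Matrix.trace A.1 = 0 := A.2
    show Matrix.trace ((g : Matrix (Fin n) (Fin n) ℂ) * A.1 * (g⁻¹ : GL (Fin n) ℂ).1) = 0
    rw [Matrix.trace_mul_comm, ← mul_assoc, Units.inv_mul, one_mul, h]⟩
  map_add' A B := Subtype.ext (by simp [mul_add, add_mul])
  map_smul' c A := Subtype.ext (by simp)

/-- The action of `GL(V)`: `g (X, Y, i, j) = (g X g⁻¹, g Y g⁻¹, i g⁻¹, g j)`. -/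
def glRep (n ℓ : ℕ) : Representation ℂ (GL (Fin n) ℂ) (QuiverRep n ℓ) where
  toFun g :=
    { toFun := fun p => (fun k => slConj g (p.1 k), fun k => slConj g (p.2.1 k),
        Matrix.vecMul p.2.2.1 (g⁻¹ : GL (Fin n) ℂ).1, Matrix.mulVec g.1 p.2.2.2)
      map_add' := fun p q => by
        ext <;> simp [Matrix.add_vecMul, Matrix.mulVec_add]
      map_smul' := fun c p => by
        ext <;> simp [Matrix.smul_vecMul, Matrix.mulVec_smul] }
  map_one' := by
    ext <;> simp [slConj]
  map_mul' g h := by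
    refine LinearMap.ext fun p => ?_
    refine Prod.ext ?_ (Prod.ext ?_ (Prod.ext ?_ ?_))
    · funext k; apply Subtype.ext; simp [slConj, mul_assoc]
    · funext k; apply Subtype.ext; simp [slConj, mul_assoc]
    · simp [Matrix.vecMul_vecMul]
    · simp [Matrix.mulVec_mulVec]

/-- The action of the torus `T = (ℂˣ)^ℓ`: it rescales the `X k`, hence, on the cotangent bundle,
`t (X, Y, i, j) = ((t k) X k, (t k)⁻¹ Y k, i, j)`. -/
def torusRep (n ℓ : ℕ) : Representation ℂ (Fin ℓ → ℂˣ) (QuiverRep n ℓ) where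
  toFun t :=
    { toFun := fun p => (fun k => (t k : ℂ) • p.1 k, fun k => ((t k)⁻¹ : ℂˣ).1 • p.2.1 k,
        p.2.2.1, p.2.2.2)
      map_add' := fun p q => by
        refine Prod.ext ?_ (Prod.ext ?_ rfl) <;> funext k <;> exact smul_add _ _ _
      map_smul' := fun c p => by
        refine Prod.ext ?_ (Prod.ext ?_ rfl) <;> funext k
        · exact smul_comm (t k : ℂ) c (p.1 k)
        · exact smul_comm ((t k)⁻¹ : ℂˣ).1 c (p.2.1 k) }
  map_one' := by
    refine LinearMap.ext fun p => ?_
    refine Prod.ext ?_ (Prod.ext ?_ rfl) <;> funext k <;> simp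
  map_mul' s t := by
    refine LinearMap.ext fun p => ?_
    refine Prod.ext ?_ (Prod.ext ?_ rfl) <;> funext k
    · simp [mul_smul]
    · simp [smul_smul, mul_comm]

/-- The moment map `μ(X, Y, i, j) = ∑ [X k, Y k] - j i`. -/
def momentMap (n ℓ : ℕ) (p : QuiverRep n ℓ) : Matrix (Fin n) (Fin n) ℂ :=
  (∑ k, ((p.1 k).1 * (p.2.1 k).1 - (p.2.1 k).1 * (p.1 k).1)) - Matrix.vecMulVec p.2.2.2 p.2.2.1

/-- The zero fibre of the moment map. -/
def momentZero (n ℓ : ℕ) : Set (QuiverRep n ℓ) := {p | momentMap n ℓ p = 0}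

/-- The character `θ = det⁻¹` of `GL(V)`. -/
def detInv (n : ℕ) : GL (Fin n) ℂ →* ℂˣ := (Matrix.GeneralLinearGroup.det)⁻¹

/-- The Nakajima quiver variety `μ⁻¹(0)^{θ-ss} //^θ GL(V)` with traceless loops, for the quiver with
one vertex, `ℓ` loops and a one-dimensional framing, `dim V = n` and `θ = det⁻¹`. -/
def quiverVariety (n ℓ : ℕ) : FunctionSpace :=
  gitQuotient (glRep n ℓ) (detInv n) (momentZero n ℓ)

theorem torusRep_comm (n ℓ : ℕ) (t : Fin ℓ → ℂˣ) (g : GL (Fin n) ℂ) (w : QuiverRep n ℓ) :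
    torusRep n ℓ t (glRep n ℓ g w) = glRep n ℓ g (torusRep n ℓ t w) := by
  refine Prod.ext ?_ (Prod.ext ?_ rfl) <;> funext k
  · exact ((slConj g).map_smul _ _).symm
  · exact ((slConj g).map_smul _ _).symm

theorem torusRep_momentZero (n ℓ : ℕ) (t : Fin ℓ → ℂˣ) (z : QuiverRep n ℓ)
    (hz : z ∈ momentZero n ℓ) : torusRep n ℓ t z ∈ momentZero n ℓ := by
  have h : momentMap n ℓ (torusRep n ℓ t z) = momentMap n ℓ z := by
    simp [momentMap, torusRep, smul_smul]
  show momentMap n ℓ _ = 0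
  rw [h]
  exact hz

/-- The action of the torus `T` on the quiver variety. -/
def torusAct (n ℓ : ℕ) (t : Fin ℓ → ℂˣ) :
    (quiverVariety n ℓ).carrier → (quiverVariety n ℓ).carrier :=
  gitAct (glRep n ℓ) (detInv n) (momentZero n ℓ) (torusRep n ℓ) (torusRep_comm n ℓ)
    (torusRep_momentZero n ℓ) t

/-- The one-parameter subgroup `t ↦ (t ^ d, 1, …, 1)` of `T = (ℂˣ)^ℓ`. -/
def nuTilde (ℓ d : ℕ) : ℂˣ →* (Fin ℓ → ℂˣ) where
  toFun t := fun k => if (k : ℕ) = 0 then t ^ d else 1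
  map_one' := by funext k; simp
  map_mul' s t := by funext k; by_cases h : (k : ℕ) = 0 <;> simp [h, mul_pow]

/-- The locus of points of the quiver variety fixed by a one-parameter subgroup `ν` of `T`, with its
structure of a subvariety. -/
def fixedLocus (n ℓ : ℕ) (ν : ℂˣ →* (Fin ℓ → ℂˣ)) : FunctionSpace :=
  (quiverVariety n ℓ).induced {p | ∀ t : ℂˣ, torusAct n ℓ (ν t) p = p}

end

/-!
If `j` and `A j` form a basis of `ℂ²` for one of the loops `A`, then writing a representation in
this basis is a normal form for its orbit, rational in the representation, and the semistable locus
is covered by these charts. Hence orbits are closed in the semistable locus and the GIT quotient has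
local sections.

A point in normal form is fixed by the torus exactly when the torus acts on it through
`g = diag(1, w)`, where `w` is the weight of `A`. If `A` is not a first loop, then `w = 1` and the
first loops, which have nontrivial weights, vanish; such points form the quiver variety with one
pair of loops fewer. If `A` is a first loop, then the weights make all later loops diagonal and
leave only the entries `A = e₂₁` and `u e₁₂` in the first pair, and the moment map equation forces
`u = 0` and `i = 0`; such points form an affine space.

The resulting injective morphism onto the fixed locus has local sections, so it is an isomorphism.
-/

namespace FunctionSpace

/-- `f` is a morphism of spaces with functions near the point `x`: it is continuous at `x` and pulls
functions regular at `f x` back to functions regular at `x`. -/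
structure MorAt (X Y : FunctionSpace) (f : X.carrier → Y.carrier) (x : X.carrier) : Prop where
  continuousAt : ContinuousAt f x
  regularAt : ∀ h : Y.carrier → ℂ, Y.RegularAt h (f x) → X.RegularAt (fun z => h (f z)) x

/-- A morphism of spaces with functions; between classical varieties, a morphism of varieties. -/
def IsMor (X Y : FunctionSpace) (f : X.carrier → Y.carrier) : Prop := ∀ x, MorAt X Y f x

variable {X Y Z : FunctionSpace}

theorem IsMor.continuous {f : X.carrier → Y.carrier} (hf : IsMor X Y f) : Continuous f :=
  continuous_iff_continuousAt.2 fun x => (hf x).continuousAt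

theorem MorAt.comp {g : Y.carrier → Z.carrier} {f : X.carrier → Y.carrier} {x : X.carrier}
    (hg : MorAt Y Z g (f x)) (hf : MorAt X Y f x) : MorAt X Z (fun z => g (f z)) x :=
  ⟨hg.continuousAt.comp hf.continuousAt, fun h hh => hf.regularAt _ (hg.regularAt h hh)⟩

theorem IsMor.comp {g : Y.carrier → Z.carrier} {f : X.carrier → Y.carrier}
    (hg : IsMor Y Z g) (hf : IsMor X Y f) : IsMor X Z (fun z => g (f z)) :=
  fun x => (hg (f x)).comp (hf x)

theorem MorAt.congr {f g : X.carrier → Y.carrier} {x : X.carrier} (hf : MorAt X Y f x)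
    (h : ∀ᶠ z in 𝓝 x, f z = g z) : MorAt X Y g x := by
  refine ⟨hf.continuousAt.congr h, fun k hk => ?_⟩
  rw [← h.self_of_nhds] at hk
  exact X.germ (h.mono fun z hz => congrArg k hz) (hf.regularAt k hk)

theorem isMor_val (S : Set X.carrier) : IsMor (X.induced S) X Subtype.val := fun _ =>
  ⟨continuous_subtype_val.continuousAt,
    fun h hh => ⟨h, hh, Filter.Eventually.of_forall fun _ => rfl⟩⟩

theorem MorAt.codRestrict {S : Set Y.carrier} {f : X.carrier → (Y.induced S).carrier}
    {x : X.carrier} (hf : MorAt X Y (fun z => (f z).1) x) : MorAt X (Y.induced S) f x := by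
  have hc : ContinuousAt f x := (Topology.IsInducing.subtypeVal.continuousAt_iff).2 hf.continuousAt
  refine ⟨hc, ?_⟩
  rintro h ⟨g, hg, hgh⟩
  exact X.germ (hc.eventually hgh) (hf.regularAt g hg)

theorem MorAt.exists_codRestrict {S : Set Y.carrier} {f : X.carrier → Y.carrier} {x : X.carrier}
    (hf : MorAt X Y f x) (hS : ∀ᶠ z in 𝓝 x, f z ∈ S) :
    ∃ f' : X.carrier → (Y.induced S).carrier,
      MorAt X (Y.induced S) f' x ∧ ∀ᶠ z in 𝓝 x, (f' z).1 = f z := by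
  classical
  let f' : X.carrier → (Y.induced S).carrier := fun z =>
    if hz : f z ∈ S then ⟨f z, hz⟩ else ⟨f x, hS.self_of_nhds⟩
  have hf' : ∀ᶠ z in 𝓝 x, (f' z).1 = f z := hS.mono fun z hz => congrArg Subtype.val (dif_pos hz)
  exact ⟨f', (hf.congr (hf'.mono fun z hz => hz.symm)).codRestrict, hf'⟩

theorem isMor_mk (r : X.carrier → X.carrier → Prop) : IsMor X (X.quotient r) (Quot.mk r) :=
  fun x => ⟨continuous_quot_mk.continuousAt, fun _ hh => hh.self_of_nhds x rfl⟩

theorem morAt_quotient {r : X.carrier → X.carrier → Prop} {f : (X.quotient r).carrier → Y.carrier}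
    {U : Set (X.quotient r).carrier} (hU : IsOpen U)
    (hf : ∀ x, Quot.mk r x ∈ U → MorAt X Y (fun z => f (Quot.mk r z)) x)
    {p : (X.quotient r).carrier} (hp : p ∈ U) : MorAt (X.quotient r) Y f p := by
  have hc : ∀ q ∈ U, ContinuousAt f q := by
    intro q hq V hV
    obtain ⟨V', hV', hVo, hqV⟩ := mem_nhds_iff.1 hV
    have ho : IsOpen (U ∩ f ⁻¹' V') := by
      refine isOpen_coinduced.2 (isOpen_iff_mem_nhds.2 ?_)
      rintro x ⟨hxU, hxV⟩
      have hzU : ∀ᶠ z in 𝓝 x, Quot.mk r z ∈ U :=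
        continuous_quot_mk.continuousAt.eventually (hU.mem_nhds hxU)
      have hzV := (hf x hxU).continuousAt.eventually (hVo.mem_nhds hxV)
      filter_upwards [hzU, hzV] with z hzU hzV using ⟨hzU, hzV⟩
    exact Filter.mem_map.2 (Filter.mem_of_superset (ho.mem_nhds ⟨hq, hqV⟩) fun z hz => hV' hz.2)
  refine ⟨hc p hp, fun h hh => ?_⟩
  filter_upwards [(hc p hp).eventually (Y.nearby hh), hU.mem_nhds hp] with q hq hqU x hx
  subst hx
  exact (hf x hqU).regularAt h hq

theorem isMor_quotient {r : X.carrier → X.carrier → Prop} {f : (X.quotient r).carrier → Y.carrier}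
    (hf : IsMor X Y (fun z => f (Quot.mk r z))) : IsMor (X.quotient r) Y f := fun _ =>
  morAt_quotient isOpen_univ (fun x _ => hf x) (Set.mem_univ _)

theorem isMor_inl : IsMor X (X.coprod Y) Sum.inl := fun _ =>
  ⟨continuous_inl.continuousAt, fun _ hh => hh⟩

theorem isMor_inr : IsMor Y (X.coprod Y) Sum.inr := fun _ =>
  ⟨continuous_inr.continuousAt, fun _ hh => hh⟩

theorem isMor_sumElim {f : X.carrier → Z.carrier} {g : Y.carrier → Z.carrier}
    (hf : IsMor X Z f) (hg : IsMor Y Z g) : IsMor (X.coprod Y) Z (Sum.elim f g) := by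
  have hc : Continuous (Sum.elim f g) := hf.continuous.sumElim hg.continuous
  rintro (x | y)
  · exact ⟨hc.continuousAt, fun h hh => (hf x).regularAt h hh⟩
  · exact ⟨hc.continuousAt, fun h hh => (hg y).regularAt h hh⟩

theorem Iso.nonempty_of_inverse {φ : X.carrier → Y.carrier} {ψ : Y.carrier → X.carrier}
    (hφ : IsMor X Y φ) (hψ : IsMor Y X ψ) (hψφ : Function.LeftInverse ψ φ)
    (hφψ : Function.RightInverse ψ φ) : Nonempty (Iso X Y) := by
  refine ⟨⟨⟨⟨φ, ψ, hψφ, hφψ⟩, hφ.continuous, hψ.continuous⟩,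
    fun f x => ⟨fun h => ?_, (hφ x).regularAt f⟩⟩⟩
  change X.RegularAt (fun z => f (φ z)) x at h
  rw [← hψφ x] at h
  have hfφψ := (hψ (φ x)).regularAt _ h
  simp only [hφψ _] at hfφψ
  exact hfφψ

theorem Iso.nonempty_of_local_sections {S : Set X.carrier} {ψ : Y.carrier → X.carrier}
    (hψ : IsMor Y X ψ) (hinj : Function.Injective ψ) (hS : ∀ y, ψ y ∈ S)
    (hloc : ∀ p : (X.induced S).carrier, ∃ s : (X.induced S).carrier → Y.carrier,
      MorAt (X.induced S) Y s p ∧ ∀ᶠ q in 𝓝 p, ψ (s q) = q.1) :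
    Nonempty (Iso (X.induced S) Y) := by
  choose s hs hψs using hloc
  have hψφ : ∀ p, ψ (s p p) = p.1 := fun p => (hψs p).self_of_nhds
  refine Iso.nonempty_of_inverse (φ := fun p => s p p) (ψ := fun y => ⟨ψ y, hS y⟩)
    (fun p => ?_) (fun y => MorAt.codRestrict (hψ y)) (fun p => Subtype.ext (hψφ p))
    fun y => hinj (hψφ _)
  exact (hs p).congr ((hψs p).mono fun q hq => hinj (hq.trans (hψφ q).symm))

end FunctionSpace

section PolynomialMaps

open FunctionSpace

variable {W W' W'' : Type} [AddCommGroup W] [Module ℂ W] [AddCommGroup W'] [Module ℂ W']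
  [AddCommGroup W''] [Module ℂ W'']

theorem dual_mem_polyFun (φ : Module.Dual ℂ W) : (fun w => φ w) ∈ polyFun W :=
  Algebra.subset_adjoin ⟨φ, rfl⟩

theorem const_mem_polyFun (c : ℂ) : (fun _ : W => c) ∈ polyFun W :=
  Subalgebra.algebraMap_mem _ c

theorem continuous_of_mem_polyFun {f : ℂ → ℂ} (hf : f ∈ polyFun ℂ) : Continuous f := by
  induction hf using Algebra.adjoin_induction with
  | mem f hf =>
    obtain ⟨φ, rfl⟩ := hf
    exact φ.continuous_of_finiteDimensional
  | algebraMap c => exact continuous_const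
  | add f g _ _ hf hg => exact hf.add hg
  | mul f g _ _ hf hg => exact hf.mul hg

/-- A polynomial map between vector spaces, without a choice of coordinates: the pullback of every
linear form is a polynomial function. -/
def IsPolyMap (F : W → W') : Prop := ∀ φ : Module.Dual ℂ W', (fun w => φ (F w)) ∈ polyFun W

theorem isPolyMap_linearMap (a : W →ₗ[ℂ] W') : IsPolyMap a := fun φ => dual_mem_polyFun (φ ∘ₗ a)

theorem isPolyMap_const (w : W') : IsPolyMap fun _ : W => w := fun φ => const_mem_polyFun (φ w)

theorem IsPolyMap.polyFun_comp {F : W → W'} (hF : IsPolyMap F) {f : W' → ℂ}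
    (hf : f ∈ polyFun W') : (fun w => f (F w)) ∈ polyFun W := by
  induction hf using Algebra.adjoin_induction with
  | mem f hf =>
    obtain ⟨φ, rfl⟩ := hf
    exact hF φ
  | algebraMap c => exact const_mem_polyFun c
  | add f g _ _ hf hg => exact add_mem hf hg
  | mul f g _ _ hf hg => exact mul_mem hf hg

theorem IsPolyMap.comp {F : W' → W''} {F' : W → W'} (hF : IsPolyMap F) (hF' : IsPolyMap F') :
    IsPolyMap fun w => F (F' w) := fun φ => hF'.polyFun_comp (hF φ)

theorem IsPolyMap.add {F F' : W → W'} (hF : IsPolyMap F) (hF' : IsPolyMap F') :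
    IsPolyMap fun w => F w + F' w := fun φ => by
  simp only [map_add]
  exact add_mem (hF φ) (hF' φ)

theorem IsPolyMap.smul {f : W → ℂ} {F : W → W'} (hf : f ∈ polyFun W) (hF : IsPolyMap F) :
    IsPolyMap fun w => f w • F w := fun φ => by
  simp only [map_smul, smul_eq_mul]
  exact mul_mem hf (hF φ)

theorem isPolyMap_add_smul (w w' : W) : IsPolyMap fun s : ℂ => w + s • w' :=
  (isPolyMap_const w).add (IsPolyMap.smul (dual_mem_polyFun LinearMap.id) (isPolyMap_const w'))

theorem IsPolyMap.prodMk {F : W → W'} {F' : W → W''} (hF : IsPolyMap F) (hF' : IsPolyMap F') :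
    IsPolyMap fun w => (F w, F' w) := by
  have hsum := ((isPolyMap_linearMap (LinearMap.inl ℂ W' W'')).comp hF).add
    ((isPolyMap_linearMap (LinearMap.inr ℂ W' W'')).comp hF')
  simpa using hsum

theorem IsPolyMap.of_injective {F : W → W'} (a : W' →ₗ[ℂ] W'') (ha : Function.Injective a)
    (hF : IsPolyMap fun w => a (F w)) : IsPolyMap F := by
  obtain ⟨b, hb⟩ := a.exists_leftInverse_of_injective (LinearMap.ker_eq_bot.2 ha)
  have hbF : IsPolyMap fun w => (b ∘ₗ a) (F w) := (isPolyMap_linearMap b).comp hF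
  simpa only [hb, LinearMap.id_apply] using hbF

theorem isPolyMap_complex_iff {f : W → ℂ} : IsPolyMap f ↔ f ∈ polyFun W := by
  refine ⟨fun hf => hf LinearMap.id, fun hf => ?_⟩
  simpa using IsPolyMap.smul hf (isPolyMap_const (1 : ℂ))

theorem isPolyMap_pi_iff {ι : Type} [Finite ι] {F : W → ι → W'} :
    IsPolyMap F ↔ ∀ k, IsPolyMap fun w => F w k := by
  classical
  have := Fintype.ofFinite ι
  refine ⟨fun hF k => (isPolyMap_linearMap (LinearMap.proj (φ := fun _ => W') k)).comp hF,
    fun hF φ => ?_⟩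
  have hsum : (fun w => φ (F w)) =
      ∑ k, fun w => (φ ∘ₗ LinearMap.single ℂ (fun _ => W') k) (F w k) := by
    funext w
    rw [Finset.sum_apply, ← LinearMap.sum_single_apply (fun _ => W') (F w), map_sum]
    simp
  rw [hsum]
  exact sum_mem fun k _ => hF k _

theorem isPolyMap_vec_iff {ι : Type} [Finite ι] {F : W → ι → ℂ} :
    IsPolyMap F ↔ ∀ k, (fun w => F w k) ∈ polyFun W := by
  simp only [isPolyMap_pi_iff, isPolyMap_complex_iff]

section Matrix

variable {l m n : Type} [Fintype m] [Finite l] [Finite n]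

theorem isPolyMap_matrix_iff {F : W → Matrix l n ℂ} :
    IsPolyMap F ↔ ∀ r s, (fun w => F w r s) ∈ polyFun W :=
  isPolyMap_pi_iff.trans (forall_congr' fun _ => isPolyMap_vec_iff)

theorem IsPolyMap.matrix_mul {A : W → Matrix l m ℂ} {B : W → Matrix m n ℂ} (hA : IsPolyMap A)
    (hB : IsPolyMap B) : IsPolyMap fun w => A w * B w := by
  rw [isPolyMap_matrix_iff] at hA hB ⊢
  intro r s
  simp only [Matrix.mul_apply, ← Finset.sum_fn]
  exact sum_mem fun k _ => mul_mem (hA r k) (hB k s)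

theorem IsPolyMap.mulVec {A : W → Matrix l m ℂ} {v : W → m → ℂ} (hA : IsPolyMap A)
    (hv : IsPolyMap v) : IsPolyMap fun w => (A w).mulVec (v w) := by
  rw [isPolyMap_matrix_iff] at hA
  rw [isPolyMap_vec_iff] at hv ⊢
  intro r
  simp only [Matrix.mulVec, dotProduct, ← Finset.sum_fn]
  exact sum_mem fun k _ => mul_mem (hA r k) (hv k)

theorem IsPolyMap.vecMul {v : W → m → ℂ} {A : W → Matrix m n ℂ} (hv : IsPolyMap v)
    (hA : IsPolyMap A) : IsPolyMap fun w => Matrix.vecMul (v w) (A w) := by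
  rw [isPolyMap_matrix_iff] at hA
  rw [isPolyMap_vec_iff] at hv ⊢
  intro s
  simp only [Matrix.vecMul, dotProduct, ← Finset.sum_fn]
  exact sum_mem fun k _ => mul_mem (hv k) (hA k s)

theorem IsPolyMap.det_mem_polyFun [DecidableEq m] {A : W → Matrix m m ℂ} (hA : IsPolyMap A) :
    (fun w => (A w).det) ∈ polyFun W := by
  rw [isPolyMap_matrix_iff] at hA
  have hprod : ∀ σ : Equiv.Perm m, (fun w => ∏ k, A w (σ k) k) ∈ polyFun W := fun σ => by
    simp only [← Finset.prod_fn]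
    exact prod_mem fun k _ => hA (σ k) k
  simp only [Matrix.det_apply', ← Finset.sum_fn]
  exact sum_mem fun σ _ => mul_mem (const_mem_polyFun _) (hprod σ)

theorem IsPolyMap.adjugate [DecidableEq m] {A : W → Matrix m m ℂ} (hA : IsPolyMap A) :
    IsPolyMap fun w => (A w).adjugate := by
  refine isPolyMap_matrix_iff.2 fun r s => ?_
  simp only [Matrix.adjugate_apply]
  refine IsPolyMap.det_mem_polyFun (isPolyMap_pi_iff.2 fun k => ?_)
  obtain rfl | hks := eq_or_ne k s
  · simpa only [Matrix.updateRow_self] using isPolyMap_const _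
  · simpa only [Matrix.updateRow_ne hks] using isPolyMap_pi_iff.1 hA k

end Matrix

theorem regularAt_of_mem_polyFun {f : W → ℂ} (hf : f ∈ polyFun W) (x : W) :
    (affineSpace W).RegularAt f x :=
  ⟨f, hf, 1, one_mem _, one_ne_zero, fun y _ => (div_one (f y)).symm⟩

theorem eventually_ne_zero_of_regularAt {f : (affineSpace W).carrier → ℂ}
    {x : (affineSpace W).carrier} (hf : (affineSpace W).RegularAt f x) (hx : f x ≠ 0) :
    ∀ᶠ y in 𝓝 x, f y ≠ 0 := by
  let _ := zariskiTopology W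
  obtain ⟨p, hp, q, hq, hqx, hfpq⟩ := hf
  rw [hfpq x hqx] at hx
  refine (isTopologicalBasis_zariski W).mem_nhds_iff.2
    ⟨_, ⟨p * q, mul_mem hp hq, rfl⟩, mul_ne_zero (div_ne_zero_iff.1 hx).1 hqx, fun y hy => ?_⟩
  have hqy : q y ≠ 0 := right_ne_zero_of_mul hy
  change f y ≠ 0
  rw [hfpq y hqy]
  exact div_ne_zero (left_ne_zero_of_mul hy) hqy

theorem regularAt_inv {f : W → ℂ} {x : W} (hf : (affineSpace W).RegularAt f x) (hx : f x ≠ 0) :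
    (affineSpace W).RegularAt (fun y => (f y)⁻¹) x := by
  obtain ⟨p, hp, q, hq, hqx, hfpq⟩ := hf
  rw [hfpq x hqx] at hx
  refine ⟨q * q, mul_mem hq hq, p * q, mul_mem hp hq,
    mul_ne_zero (div_ne_zero_iff.1 hx).1 hqx, fun y hy => ?_⟩
  have hqy : q y ≠ 0 := right_ne_zero_of_mul hy
  change (f y)⁻¹ = q y * q y / (p y * q y)
  rw [hfpq y hqy, inv_div]
  exact (mul_div_mul_right _ _ hqy).symm

theorem morAt_affineSpace {F : (affineSpace W).carrier → (affineSpace W').carrier} {x : W}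
    (hF : ∀ φ : Module.Dual ℂ W', (affineSpace W).RegularAt (fun w => φ (F w)) x) :
    MorAt (affineSpace W) (affineSpace W') F x := by
  have hpoly : ∀ q ∈ polyFun W', (affineSpace W).RegularAt (fun w => q (F w)) x := by
    intro q hq
    induction hq using Algebra.adjoin_induction with
    | mem f hf =>
      obtain ⟨φ, rfl⟩ := hf
      exact hF φ
    | algebraMap c => exact (affineSpace W).const c x
    | add f g _ _ hf hg => exact (affineSpace W).add hf hg
    | mul f g _ _ hf hg => exact (affineSpace W).mul hf hg
  refine ⟨fun V hV => ?_, ?_⟩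
  · let _ := zariskiTopology W'
    obtain ⟨_, ⟨q, hq, rfl⟩, hqx, hqV⟩ := (isTopologicalBasis_zariski W').mem_nhds_iff.1 hV
    exact (eventually_ne_zero_of_regularAt (hpoly q hq) hqx).mono fun w hw => hqV hw
  · rintro k ⟨p, hp, q, hq, hqx, hkpq⟩
    refine (affineSpace W).germ ?_
      ((affineSpace W).mul (hpoly p hp) (regularAt_inv (hpoly q hq) hqx))
    exact (eventually_ne_zero_of_regularAt (hpoly q hq) hqx).mono fun w hw =>
      (hkpq (F w) hw).symm

theorem IsPolyMap.isMor {F : W → W'} (hF : IsPolyMap F) :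
    IsMor (affineSpace W) (affineSpace W') F := fun x =>
  morAt_affineSpace fun φ => regularAt_of_mem_polyFun (hF φ) x

theorem morAt_inv_smul {δ : W → ℂ} (hδ : δ ∈ polyFun W) {F : W → W'} (hF : IsPolyMap F) {x : W}
    (hx : δ x ≠ 0) :
    MorAt (affineSpace W) (affineSpace W') (fun w : W => ((δ w)⁻¹ • F w : W')) x := by
  refine morAt_affineSpace fun φ => ?_
  simp only [map_smul, smul_eq_mul]
  exact (affineSpace W).mul (regularAt_inv (regularAt_of_mem_polyFun hδ x) hx)
    (regularAt_of_mem_polyFun (hF φ) x)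

theorem isOpen_polyFun_ne_zero {f : W → ℂ} (hf : f ∈ polyFun W) :
    IsOpen {y : (affineSpace W).carrier | f y ≠ 0} := by
  let _ := zariskiTopology W
  exact (isTopologicalBasis_zariski W).isOpen ⟨f, hf, rfl⟩

end PolynomialMaps

section GIT

open FunctionSpace

variable {G W W' : Type} [Group G] [AddCommGroup W] [Module ℂ W] [AddCommGroup W'] [Module ℂ W']
  {ρ : Representation ℂ G W} {ρ' : Representation ℂ G W'} {θ : G →* ℂˣ} {Z : Set W} {Z' : Set W'}

theorem smul_mem_semistable (hZ : ∀ g, ∀ z ∈ Z, ρ g z ∈ Z) (g : G) {x : W}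
    (hx : x ∈ semistable ρ θ Z) : ρ g x ∈ semistable ρ θ Z := by
  obtain ⟨hxZ, m, hm, f, hf, hinv, hfx⟩ := hx
  refine ⟨hZ g x hxZ, m, hm, f, hf, hinv, fun h0 => hfx ?_⟩
  rw [← ρ.inv_self_apply g x, hinv g _ (hZ g x hxZ), h0, mul_zero]

/-- The easy half of the Hilbert–Mumford criterion: a semi-invariant is multiplied by a negative
power of `s` along `ρ (γ s) x`, so it cannot stay bounded as `s → 0` unless it vanishes at `x`. -/
theorem notMem_semistable_of_oneParameter {x : W} {γ : ℂˣ → G} {k : ℕ} (hk : 0 < k)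
    (hθ : ∀ s, θ (γ s) = s ^ k) {c : ℂ → W} (hc : IsPolyMap c)
    (hγc : ∀ s : ℂˣ, ρ (γ s) x = c s) : x ∉ semistable ρ θ Z := by
  rintro ⟨hxZ, m, hm, f, hf, hinv, hfx⟩
  have hweight : ∀ s : ℂ, s ≠ 0 → s ^ (k * m) * f (c s) = f x := fun s hs => by
    have h := hinv (γ (Units.mk0 s hs))⁻¹ x hxZ
    rw [inv_inv, hγc, map_inv, hθ, Units.val_inv_eq_inv_val, Units.val_pow_eq_pow_val,
      Units.val_mk0, inv_pow, ← pow_mul] at h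
    rw [h, mul_inv_cancel_left₀ (pow_ne_zero _ hs)]
  have hcont : Continuous fun s : ℂ => s ^ (k * m) * f (c s) :=
    (continuous_pow _).mul (continuous_of_mem_polyFun (hc.polyFun_comp hf))
  have hconst : (fun s : ℂ => s ^ (k * m) * f (c s)) = fun _ => f x :=
    hcont.ext_on (dense_compl_singleton 0) continuous_const hweight
  refine hfx ((congrFun hconst 0).symm.trans ?_)
  simp only [zero_pow (Nat.mul_pos hk hm).ne', zero_mul]

/-- The class of a semistable point in the GIT quotient. -/
def gitMk (x : W) (hx : x ∈ semistable ρ θ Z) : (gitQuotient ρ θ Z).carrier :=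
  Quot.mk _ ⟨x, hx⟩

theorem exists_gitMk_eq (p : (gitQuotient ρ θ Z).carrier) : ∃ x hx, gitMk x hx = p := by
  obtain ⟨⟨x, hx⟩, rfl⟩ := Quot.exists_rep p
  exact ⟨x, hx, rfl⟩

theorem exists_morAt_gitMk {X : FunctionSpace} {F : X.carrier → W} {p : X.carrier}
    (hF : MorAt X (affineSpace W) F p)
    (hss : ∀ᶠ q in 𝓝 p, F q ∈ semistable ρ θ Z) :
    ∃ s : X.carrier → (gitQuotient ρ θ Z).carrier, MorAt X (gitQuotient ρ θ Z) s p ∧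
      ∀ᶠ q in 𝓝 p, ∃ hq, s q = gitMk (F q) hq := by
  obtain ⟨F', hF', hFF'⟩ := hF.exists_codRestrict hss
  refine ⟨fun q => Quot.mk _ (F' q), (isMor_mk (orbitClosuresMeet ρ θ Z) _).comp hF', ?_⟩
  filter_upwards [hss, hFF'] with q hq hFq
  exact ⟨hq, congrArg (Quot.mk _) (Subtype.ext hFq)⟩

/-- An equivariant polynomial map preserving semistability, on the semistable loci. -/
def semistableMap (F : W → W') (hss : ∀ x ∈ semistable ρ θ Z, F x ∈ semistable ρ' θ Z')
    (x : (semistableSpace ρ θ Z).carrier) : (semistableSpace ρ' θ Z').carrier :=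
  ⟨F x.1, hss x.1 x.2⟩

theorem isMor_semistableMap {F : W → W'} (hF : IsPolyMap F)
    (hss : ∀ x ∈ semistable ρ θ Z, F x ∈ semistable ρ' θ Z') :
    IsMor (semistableSpace ρ θ Z) (semistableSpace ρ' θ Z') (semistableMap F hss) := fun x =>
  MorAt.codRestrict ((hF.isMor x.1).comp (isMor_val _ x))

theorem semistableMap_mem_closure {F : W → W'} (hF : IsPolyMap F)
    (hequiv : ∀ g x, F (ρ g x) = ρ' g (F x))
    (hss : ∀ x ∈ semistable ρ θ Z, F x ∈ semistable ρ' θ Z')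
    {x z : (semistableSpace ρ θ Z).carrier} (hz : z ∈ closure (semistableOrbit ρ θ Z x)) :
    semistableMap F hss z ∈ closure (semistableOrbit ρ' θ Z' (semistableMap F hss x)) := by
  refine map_mem_closure (isMor_semistableMap hF hss).continuous hz ?_
  rintro y ⟨g, hg⟩
  exact ⟨g, (congrArg F hg).trans (hequiv g x.1)⟩

/-- The map of GIT quotients induced by an equivariant polynomial map that preserves
semistability. -/
def gitMap (F : W → W') (hF : IsPolyMap F) (hequiv : ∀ g x, F (ρ g x) = ρ' g (F x))
    (hss : ∀ x ∈ semistable ρ θ Z, F x ∈ semistable ρ' θ Z') :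
    (gitQuotient ρ θ Z).carrier → (gitQuotient ρ' θ Z').carrier :=
  Quot.map (semistableMap F hss) fun _ _ ⟨z, hzx, hzy⟩ =>
    ⟨semistableMap F hss z, semistableMap_mem_closure hF hequiv hss hzx,
      semistableMap_mem_closure hF hequiv hss hzy⟩

theorem isMor_gitMap {F : W → W'} (hF : IsPolyMap F) (hequiv : ∀ g x, F (ρ g x) = ρ' g (F x))
    (hss : ∀ x ∈ semistable ρ θ Z, F x ∈ semistable ρ' θ Z') :
    IsMor (gitQuotient ρ θ Z) (gitQuotient ρ' θ Z') (gitMap F hF hequiv hss) :=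
  isMor_quotient ((isMor_mk _).comp (isMor_semistableMap hF hss))

/-- A rational slice for a representation: on the invariant principal open set `den ≠ 0`, every
orbit has a distinguished point, which depends rationally on the point of the orbit, as
`den⁻¹ • num`. -/
structure RationalNormalForm (ρ : Representation ℂ G W) where
  den : W → ℂ
  num : W → W
  den_mem : den ∈ polyFun W
  isPolyMap_num : IsPolyMap num
  den_smul_eq_zero_iff : ∀ g x, den (ρ g x) = 0 ↔ den x = 0
  inv_den_smul_num : ∀ g x, (den (ρ g x))⁻¹ • num (ρ g x) = (den x)⁻¹ • num x
  exists_eq_smul : ∀ x, den x ≠ 0 → ∃ g, (den x)⁻¹ • num x = ρ g x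

namespace RationalNormalForm

variable (N : RationalNormalForm ρ)

/-- The distinguished point of the orbit of `x`; it is the junk value `0` where `den` vanishes. -/
noncomputable def eval (x : W) : W := (N.den x)⁻¹ • N.num x

theorem morAt_eval {x : W} (hx : N.den x ≠ 0) :
    MorAt (affineSpace W) (affineSpace W) N.eval x :=
  morAt_inv_smul N.den_mem N.isPolyMap_num hx

/-- Clearing denominators, `eval y = eval x` is a polynomial equation in `y`, which passes from the
orbit of `x` to its closure. -/
theorem eval_eq_of_mem_closure {x z : W} {hx : x ∈ semistable ρ θ Z} {hz : z ∈ semistable ρ θ Z}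
    (hzx : ⟨z, hz⟩ ∈ closure (semistableOrbit ρ θ Z ⟨x, hx⟩)) (hden : N.den z ≠ 0) :
    N.den x ≠ 0 ∧ N.eval z = N.eval x := by
  have hmeets : ∀ f ∈ polyFun W, f z ≠ 0 → ∃ g, f (ρ g x) ≠ 0 := fun f hf hfz => by
    have hopen : IsOpen {y : (semistableSpace ρ θ Z).carrier | f y.1 ≠ 0} :=
      (isOpen_polyFun_ne_zero hf).preimage (isMor_val _).continuous
    obtain ⟨⟨y, _⟩, hfy, g, hg⟩ := mem_closure_iff.1 hzx _ hopen hfz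
    obtain rfl : y = ρ g x := hg
    exact ⟨g, hfy⟩
  have hdenx : N.den x ≠ 0 := by
    obtain ⟨g, hg⟩ := hmeets _ N.den_mem hden
    rwa [Ne, N.den_smul_eq_zero_iff] at hg
  have hcleared : ∀ φ : Module.Dual ℂ W, φ (N.num z) + N.den z * -φ (N.eval x) = 0 := fun φ => by
    by_contra hne
    obtain ⟨g, hg⟩ := hmeets _ (add_mem (N.isPolyMap_num φ)
      (mul_mem N.den_mem (const_mem_polyFun (-φ (N.eval x))))) hne
    have hdeng : N.den (ρ g x) ≠ 0 := by rwa [Ne, N.den_smul_eq_zero_iff]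
    have heval : (N.den (ρ g x))⁻¹ • N.num (ρ g x) = N.eval x := N.inv_den_smul_num g x
    refine hg ?_
    change φ (N.num (ρ g x)) + N.den (ρ g x) * -φ (N.eval x) = 0
    rw [← heval, map_smul, smul_eq_mul, mul_neg, mul_inv_cancel_left₀ hdeng, add_neg_cancel]
  refine ⟨hdenx, sub_eq_zero.1 ((Module.forall_dual_apply_eq_zero_iff ℂ _).1 fun φ => ?_)⟩
  rw [map_sub, sub_eq_zero, eval, map_smul, smul_eq_mul, inv_mul_eq_iff_eq_mul₀ hden]
  linear_combination hcleared φ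

end RationalNormalForm

/-- Rational normal forms whose domains cover the semistable locus of a stable subset. -/
structure NormalFormAtlas (ρ : Representation ℂ G W) (θ : G →* ℂˣ) (Z : Set W) (ι : Type) where
  chart : ι → RationalNormalForm ρ
  smul_mem : ∀ g, ∀ z ∈ Z, ρ g z ∈ Z
  exists_den_ne_zero : ∀ x ∈ semistable ρ θ Z, ∃ i, (chart i).den x ≠ 0

namespace NormalFormAtlas

variable {ι : Type} (𝒜 : NormalFormAtlas ρ θ Z ι)

include 𝒜 in
theorem orbitClosuresMeet_iff {x y : W} {hx : x ∈ semistable ρ θ Z} {hy : y ∈ semistable ρ θ Z} :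
    orbitClosuresMeet ρ θ Z ⟨x, hx⟩ ⟨y, hy⟩ ↔ ∃ g, y = ρ g x := by
  constructor
  · rintro ⟨⟨z, hz⟩, hzx, hzy⟩
    obtain ⟨i, hi⟩ := 𝒜.exists_den_ne_zero z hz
    obtain ⟨hx, hzx⟩ := (𝒜.chart i).eval_eq_of_mem_closure hzx hi
    obtain ⟨hy, hzy⟩ := (𝒜.chart i).eval_eq_of_mem_closure hzy hi
    obtain ⟨g, hg⟩ := (𝒜.chart i).exists_eq_smul _ hx
    obtain ⟨h, hh⟩ := (𝒜.chart i).exists_eq_smul _ hy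
    have hgh : ρ h y = ρ g x := hh.symm.trans (hzy.symm.trans (hzx.trans hg))
    refine ⟨h⁻¹ * g, ?_⟩
    rw [map_mul, Module.End.mul_apply, ← hgh, ρ.inv_self_apply]
  · intro hyx
    exact ⟨⟨y, hy⟩, subset_closure hyx, subset_closure ⟨1, by rw [map_one]; rfl⟩⟩

include 𝒜 in
theorem gitMk_eq_gitMk_iff {x y : W} {hx : x ∈ semistable ρ θ Z} {hy : y ∈ semistable ρ θ Z} :
    gitMk x hx = gitMk y hy ↔ ∃ g, y = ρ g x := by
  have heqv : Equivalence (orbitClosuresMeet ρ θ Z) := by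
    refine ⟨fun ⟨x, _⟩ => 𝒜.orbitClosuresMeet_iff.2 ⟨1, by rw [map_one]; rfl⟩,
      fun h => h.imp fun z hz => hz.symm, ?_⟩
    rintro ⟨x, _⟩ ⟨y, _⟩ ⟨z, _⟩ hxy hyz
    obtain ⟨g, rfl⟩ := 𝒜.orbitClosuresMeet_iff.1 hxy
    obtain ⟨h, rfl⟩ := 𝒜.orbitClosuresMeet_iff.1 hyz
    exact 𝒜.orbitClosuresMeet_iff.2 ⟨h * g, by rw [map_mul]; rfl⟩
  exact Quot.eq.trans (heqv.eqvGen_iff.trans 𝒜.orbitClosuresMeet_iff)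

/-- The open subset of the GIT quotient over which the chart `i` is defined. -/
def locus (i : ι) : Set (gitQuotient ρ θ Z).carrier :=
  {p | Quot.lift (fun x : semistable ρ θ Z => (𝒜.chart i).den x.1 ≠ 0)
    (fun ⟨_, _⟩ ⟨_, _⟩ h => by
      obtain ⟨g, rfl⟩ := 𝒜.orbitClosuresMeet_iff.1 h
      exact propext (not_congr ((𝒜.chart i).den_smul_eq_zero_iff g _).symm)) p}

/-- The section of the GIT quotient over `locus i` given by the normal form `i`. -/
noncomputable def normalForm (i : ι) : (gitQuotient ρ θ Z).carrier → W :=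
  Quot.lift (fun x : semistable ρ θ Z => (𝒜.chart i).eval x.1) fun ⟨_, _⟩ ⟨_, _⟩ h => by
    obtain ⟨g, rfl⟩ := 𝒜.orbitClosuresMeet_iff.1 h
    exact ((𝒜.chart i).inv_den_smul_num g _).symm

theorem gitMk_mem_locus_iff {i : ι} {x : W} {hx : x ∈ semistable ρ θ Z} :
    gitMk x hx ∈ 𝒜.locus i ↔ (𝒜.chart i).den x ≠ 0 := Iff.rfl

theorem normalForm_gitMk (i : ι) {x : W} (hx : x ∈ semistable ρ θ Z) :
    𝒜.normalForm i (gitMk x hx) = (𝒜.chart i).eval x := rfl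

theorem exists_mem_locus (p : (gitQuotient ρ θ Z).carrier) : ∃ i, p ∈ 𝒜.locus i := by
  obtain ⟨x, hx, rfl⟩ := exists_gitMk_eq p
  exact 𝒜.exists_den_ne_zero x hx

theorem isOpen_locus (i : ι) : IsOpen (𝒜.locus i) :=
  isOpen_coinduced.2
    ((isOpen_polyFun_ne_zero (𝒜.chart i).den_mem).preimage (isMor_val _).continuous)

theorem morAt_normalForm {i : ι} {p : (gitQuotient ρ θ Z).carrier} (hp : p ∈ 𝒜.locus i) :
    MorAt (gitQuotient ρ θ Z) (affineSpace W) (𝒜.normalForm i) p :=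
  morAt_quotient (𝒜.isOpen_locus i)
    (fun x hx => ((𝒜.chart i).morAt_eval hx).comp (isMor_val _ x)) hp

theorem exists_gitMk_normalForm {i : ι} {p : (gitQuotient ρ θ Z).carrier} (hp : p ∈ 𝒜.locus i) :
    ∃ h, gitMk (𝒜.normalForm i p) h = p := by
  obtain ⟨x, hx, rfl⟩ := exists_gitMk_eq p
  obtain ⟨g, hg⟩ := (𝒜.chart i).exists_eq_smul x hp
  have hnf : 𝒜.normalForm i (gitMk x hx) = ρ g x := hg
  refine ⟨hnf ▸ smul_mem_semistable 𝒜.smul_mem g hx, ?_⟩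
  exact (𝒜.gitMk_eq_gitMk_iff.2 ⟨g, hnf⟩).symm

end NormalFormAtlas

end GIT

section QuiverRep

open LieAlgebra.SpecialLinear
open scoped Matrix

variable {n ℓ : ℕ}

-- A shortcut: the search through the Lie subalgebra structure is slow.
instance : AddCommMonoid (sl (Fin n) ℂ) := inferInstance

/-- The inclusion of the traceless matrices. -/
def slIncl (n : ℕ) : sl (Fin n) ℂ →ₗ[ℂ] Matrix (Fin n) (Fin n) ℂ where
  toFun A := A.1
  map_add' _ _ := rfl
  map_smul' _ _ := rfl

theorem isPolyMap_sl {W : Type} [AddCommGroup W] [Module ℂ W] {A : W → sl (Fin n) ℂ}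
    (hA : IsPolyMap fun w => (A w).1) : IsPolyMap A :=
  IsPolyMap.of_injective (slIncl n) Subtype.val_injective hA

/-- The loops of a representation: `loop true k` is `X k` and `loop false k` is `Y k`. -/
def loop (b : Bool) (k : Fin ℓ) : QuiverRep n ℓ →ₗ[ℂ] sl (Fin n) ℂ :=
  match b with
  | true => LinearMap.proj k ∘ₗ LinearMap.fst ℂ _ _
  | false => LinearMap.proj k ∘ₗ LinearMap.fst ℂ _ _ ∘ₗ LinearMap.snd ℂ _ _

/-- The loops of a representation as matrices, with the indexing of `loop`. -/
def loopMat (b : Bool) (k : Fin ℓ) : QuiverRep n ℓ →ₗ[ℂ] Matrix (Fin n) (Fin n) ℂ :=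
  slIncl n ∘ₗ loop b k

/-- The component `i` of a representation `(X, Y, i, j)`. -/
def covector : QuiverRep n ℓ →ₗ[ℂ] Fin n → ℂ :=
  LinearMap.fst ℂ _ _ ∘ₗ LinearMap.snd ℂ _ _ ∘ₗ LinearMap.snd ℂ _ _

/-- The component `j` of a representation `(X, Y, i, j)`. -/
def vector : QuiverRep n ℓ →ₗ[ℂ] Fin n → ℂ :=
  LinearMap.snd ℂ _ _ ∘ₗ LinearMap.snd ℂ _ _ ∘ₗ LinearMap.snd ℂ _ _

theorem isPolyMap_covector : IsPolyMap fun x : QuiverRep n ℓ => covector x :=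
  isPolyMap_linearMap covector

theorem isPolyMap_vector : IsPolyMap fun x : QuiverRep n ℓ => vector x :=
  isPolyMap_linearMap vector

/-- The representation with given loops, covector and vector. -/
def mkRep (A : Bool → Fin ℓ → sl (Fin n) ℂ) (i j : Fin n → ℂ) : QuiverRep n ℓ :=
  (A true, A false, i, j)

@[simp] theorem loop_mkRep (A : Bool → Fin ℓ → sl (Fin n) ℂ) (i j : Fin n → ℂ) (b : Bool)
    (k : Fin ℓ) : loop b k (mkRep A i j) = A b k := by
  cases b <;> rfl

@[simp] theorem loopMat_mkRep (A : Bool → Fin ℓ → sl (Fin n) ℂ) (i j : Fin n → ℂ) (b : Bool)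
    (k : Fin ℓ) : loopMat b k (mkRep A i j) = (A b k).1 :=
  congrArg Subtype.val (loop_mkRep A i j b k)

@[simp] theorem covector_mkRep (A : Bool → Fin ℓ → sl (Fin n) ℂ) (i j : Fin n → ℂ) :
    covector (mkRep A i j) = i := rfl

@[simp] theorem vector_mkRep (A : Bool → Fin ℓ → sl (Fin n) ℂ) (i j : Fin n → ℂ) :
    vector (mkRep A i j) = j := rfl

theorem quiverRep_ext {x y : QuiverRep n ℓ} (hloop : ∀ b k, loopMat b k x = loopMat b k y)
    (hcovector : covector x = covector y) (hvector : vector x = vector y) : x = y :=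
  Prod.ext (funext fun k => Subtype.ext (hloop true k))
    (Prod.ext (funext fun k => Subtype.ext (hloop false k)) (Prod.ext hcovector hvector))

theorem isPolyMap_mkRep {W : Type} [AddCommGroup W] [Module ℂ W]
    {A : W → Bool → Fin ℓ → sl (Fin n) ℂ} {i j : W → Fin n → ℂ}
    (hA : ∀ b k, IsPolyMap fun w => (A w b k).1) (hi : IsPolyMap i) (hj : IsPolyMap j) :
    IsPolyMap fun w => mkRep (A w) (i w) (j w) :=
  (isPolyMap_pi_iff.2 fun k => isPolyMap_sl (hA true k)).prodMk
    ((isPolyMap_pi_iff.2 fun k => isPolyMap_sl (hA false k)).prodMk (hi.prodMk hj))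

@[simp] theorem loopMat_glRep (b : Bool) (k : Fin ℓ) (g : GL (Fin n) ℂ) (x : QuiverRep n ℓ) :
    loopMat b k (glRep n ℓ g x) = g.1 * loopMat b k x * (g⁻¹).1 := by
  cases b <;> rfl

@[simp] theorem covector_glRep (g : GL (Fin n) ℂ) (x : QuiverRep n ℓ) :
    covector (glRep n ℓ g x) = covector x ᵥ* (g⁻¹).1 := rfl

@[simp] theorem vector_glRep (g : GL (Fin n) ℂ) (x : QuiverRep n ℓ) :
    vector (glRep n ℓ g x) = g.1 *ᵥ vector x := rfl

theorem momentMap_eq (x : QuiverRep n ℓ) :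
    momentMap n ℓ x =
      ∑ k, (loopMat true k x * loopMat false k x - loopMat false k x * loopMat true k x) -
        Matrix.vecMulVec (vector x) (covector x) := rfl

theorem momentMap_glRep (g : GL (Fin n) ℂ) (x : QuiverRep n ℓ) :
    momentMap n ℓ (glRep n ℓ g x) = g.1 * momentMap n ℓ x * (g⁻¹).1 := by
  have hconj : ∀ A B : Matrix (Fin n) (Fin n) ℂ,
      g.1 * A * (g⁻¹).1 * (g.1 * B * (g⁻¹).1) = g.1 * (A * B) * (g⁻¹).1 := fun A B => by
    simp only [mul_assoc, Units.inv_mul_cancel_left]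
  simp only [momentMap_eq, loopMat_glRep, covector_glRep, vector_glRep, hconj, mul_sub, sub_mul,
    Finset.mul_sum, Finset.sum_mul, Matrix.mul_vecMulVec, Matrix.vecMulVec_mul]

theorem glRep_mem_momentZero (g : GL (Fin n) ℂ) {x : QuiverRep n ℓ} (hx : x ∈ momentZero n ℓ) :
    glRep n ℓ g x ∈ momentZero n ℓ := by
  have hx : momentMap n ℓ x = 0 := hx
  change momentMap n ℓ (glRep n ℓ g x) = 0
  rw [momentMap_glRep, hx, mul_zero, zero_mul]

/-- The diagonal matrices with nonzero entries, as elements of the general linear group. -/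
def diagGL (v : Fin n → ℂˣ) : GL (Fin n) ℂ where
  val := Matrix.diagonal fun r => (v r : ℂ)
  inv := Matrix.diagonal fun r => ((v r)⁻¹ : ℂˣ)
  val_inv := by simp only [Matrix.diagonal_mul_diagonal, Units.mul_inv, Matrix.diagonal_one]
  inv_val := by simp only [Matrix.diagonal_mul_diagonal, Units.inv_mul, Matrix.diagonal_one]

theorem detInv_diagGL (v : Fin n → ℂˣ) : detInv n (diagGL v) = (∏ r, v r)⁻¹ := by
  refine congrArg (·⁻¹) (Units.ext ?_)
  rw [Units.coe_prod]
  exact Matrix.det_diagonal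

theorem loopMat_glRep_diagGL (v : Fin n → ℂˣ) (b : Bool) (k : Fin ℓ) (x : QuiverRep n ℓ)
    (r s : Fin n) :
    loopMat b k (glRep n ℓ (diagGL v) x) r s = v r * loopMat b k x r s * ((v s)⁻¹ : ℂˣ) := by
  rw [loopMat_glRep]
  exact (Matrix.mul_diagonal ..).trans (congrArg (· * _) (Matrix.diagonal_mul ..))

theorem covector_glRep_diagGL (v : Fin n → ℂˣ) (x : QuiverRep n ℓ) (s : Fin n) :
    covector (glRep n ℓ (diagGL v) x) s = covector x s * ((v s)⁻¹ : ℂˣ) := by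
  rw [covector_glRep]
  exact Matrix.vecMul_diagonal ..

theorem vector_glRep_diagGL (v : Fin n → ℂˣ) (x : QuiverRep n ℓ) (r : Fin n) :
    vector (glRep n ℓ (diagGL v) x) r = v r * vector x r := by
  rw [vector_glRep]
  exact Matrix.mulVec_diagonal ..

end QuiverRep

section Frame

open LieAlgebra.SpecialLinear
open scoped Matrix

variable {n ℓ : ℕ}

/-- `A ↦ adj(M) A M` on traceless matrices. -/
def adjConj (M : Matrix (Fin n) (Fin n) ℂ) (A : sl (Fin n) ℂ) : sl (Fin n) ℂ :=
  ⟨M.adjugate * A.1 * M, by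
    change Matrix.trace (M.adjugate * A.1 * M) = 0
    have hA : Matrix.trace A.1 = 0 := A.2
    rw [Matrix.trace_mul_cycle, Matrix.mul_adjugate, Matrix.smul_mul, one_mul, Matrix.trace_smul,
      hA, smul_zero]⟩

/-- For a matrix `M` with inverse `g`, the representation `det M • g (X, Y, i, j)`, which is
polynomial in `M`. -/
def adjRep (M : Matrix (Fin n) (Fin n) ℂ) (x : QuiverRep n ℓ) : QuiverRep n ℓ :=
  mkRep (fun b k => adjConj M (loop b k x)) (M.det • covector x ᵥ* M) (M.adjugate *ᵥ vector x)

theorem isPolyMap_adjRep {F : QuiverRep n ℓ → Matrix (Fin n) (Fin n) ℂ} (hF : IsPolyMap F) :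
    IsPolyMap fun x => adjRep (F x) x :=
  isPolyMap_mkRep
    (fun b k => (hF.adjugate.matrix_mul (isPolyMap_linearMap (loopMat b k))).matrix_mul hF)
    (IsPolyMap.smul hF.det_mem_polyFun (isPolyMap_covector.vecMul hF))
    (hF.adjugate.mulVec isPolyMap_vector)

theorem inv_det_smul_adjRep (g : GL (Fin n) ℂ) (x : QuiverRep n ℓ) :
    (g.1.det)⁻¹ • adjRep g.1 x = glRep n ℓ g⁻¹ x := by
  have hdet : g.1.det ≠ 0 := g.det.ne_zero
  have hinv : (g⁻¹).1 = (g.1.det)⁻¹ • g.1.adjugate := by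
    rw [Matrix.coe_units_inv, Matrix.inv_def, Ring.inverse_eq_inv']
  refine quiverRep_ext (fun b k => ?_) ?_ ?_
  · rw [map_smul, loopMat_glRep, inv_inv, hinv, Matrix.smul_mul, Matrix.smul_mul, adjRep,
      loopMat_mkRep]
    rfl
  · rw [map_smul, covector_glRep, inv_inv, adjRep, covector_mkRep, inv_smul_smul₀ hdet]
  · rw [map_smul, vector_glRep, hinv, adjRep, vector_mkRep, Matrix.smul_mulVec]

namespace RationalNormalForm

variable (F : QuiverRep n ℓ → Matrix (Fin n) (Fin n) ℂ) (hF : IsPolyMap F)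
  (hequiv : ∀ g x, F (glRep n ℓ g x) = g.1 * F x)

/-- An equivariant polynomial family of `n` vectors in `V = ℂⁿ` gives a normal form where it is a
basis: the representation written in this basis. -/
def ofFrame : RationalNormalForm (glRep n ℓ) where
  den x := (F x).det
  num x := adjRep (F x) x
  den_mem := hF.det_mem_polyFun
  isPolyMap_num := isPolyMap_adjRep hF
  den_smul_eq_zero_iff g x := by
    rw [hequiv, Matrix.det_mul, mul_eq_zero, or_iff_right (Matrix.GeneralLinearGroup.det_ne_zero g)]
  inv_den_smul_num g x := by
    by_cases hdet : (F x).det = 0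
    · rw [hequiv, Matrix.det_mul, hdet, mul_zero, inv_zero, zero_smul, zero_smul]
    · obtain ⟨u, hu⟩ : ∃ u : GL (Fin n) ℂ, u.1 = F x :=
        ⟨Matrix.GeneralLinearGroup.mkOfDetNeZero _ hdet, rfl⟩
      rw [hequiv, ← hu, ← Units.val_mul, inv_det_smul_adjRep, inv_det_smul_adjRep, mul_inv_rev,
        map_mul, Module.End.mul_apply, Representation.inv_self_apply]
  exists_eq_smul x hdet :=
    ⟨_, inv_det_smul_adjRep (Matrix.GeneralLinearGroup.mkOfDetNeZero (F x) hdet) x⟩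

theorem frame_eval {x : QuiverRep n ℓ} (hx : (F x).det ≠ 0) :
    F ((ofFrame F hF hequiv).eval x) = 1 := by
  have heval : (ofFrame F hF hequiv).eval x = _ :=
    inv_det_smul_adjRep (Matrix.GeneralLinearGroup.mkOfDetNeZero (F x) hx) x
  rw [heval, hequiv]
  exact Units.inv_mul _

theorem eval_of_frame_eq_one {x : QuiverRep n ℓ} (hx : F x = 1) :
    (ofFrame F hF hequiv).eval x = x := by
  change (F x).det⁻¹ • adjRep (F x) x = x
  have h := inv_det_smul_adjRep 1 x
  rw [inv_one, map_one] at h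
  rw [hx]
  exact h

end RationalNormalForm

end Frame

section LoopFrame

open LieAlgebra.SpecialLinear
open scoped Matrix

variable {n ℓ : ℕ}

theorem notMem_semistable_of_vector_eq_zero (hn : 0 < n) {x : QuiverRep n ℓ} (hx : vector x = 0) :
    x ∉ semistable (glRep n ℓ) (detInv n) (momentZero n ℓ) := by
  have hdet (s : ℂˣ) : detInv n (diagGL fun _ => s⁻¹) = s ^ n := by
    rw [detInv_diagGL, Finset.prod_const, Finset.card_univ, Fintype.card_fin, inv_pow, inv_inv]
  refine notMem_semistable_of_oneParameter hn hdet
    (isPolyMap_add_smul (mkRep (fun b k => loop b k x) 0 0) (mkRep (fun _ _ => 0) (covector x) 0))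
    fun s => ?_
  refine quiverRep_ext (fun b k => Matrix.ext fun r q => ?_) (funext fun q => ?_)
    (funext fun r => ?_)
  · have hconj : ((s⁻¹ : ℂˣ) : ℂ) * loopMat b k x r q * ((s⁻¹)⁻¹ : ℂˣ) = loopMat b k x r q := by
      rw [mul_right_comm, Units.mul_inv, one_mul]
    rw [loopMat_glRep_diagGL, hconj, map_add, map_smul, loopMat_mkRep, loopMat_mkRep,
      ZeroMemClass.coe_zero, smul_zero, add_zero]
    rfl
  · simp [covector_glRep_diagGL, mul_comm]
  · simp [vector_glRep_diagGL, hx]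

theorem loopMat_one_one (b : Bool) (k : Fin ℓ) (x : QuiverRep 2 ℓ) :
    loopMat b k x 1 1 = -loopMat b k x 0 0 := by
  have htrace : (loopMat b k x).trace = 0 := (loop b k x).2
  rwa [Matrix.trace_fin_two, add_comm, add_eq_zero_iff_eq_neg] at htrace

/-- A subrepresentation of dimension one containing `j` destabilises. -/
theorem notMem_semistable_of_upper_triangular {x : QuiverRep 2 ℓ} (hvector : vector x = ![1, 0])
    (hloop : ∀ b k, loopMat b k x 1 0 = 0) :
    x ∉ semistable (glRep 2 ℓ) (detInv 2) (momentZero 2 ℓ) := by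
  have hdet (s : ℂˣ) : detInv 2 (diagGL ![1, s⁻¹]) = s ^ 1 := by
    simp [detInv_diagGL]
  refine notMem_semistable_of_oneParameter one_pos hdet
    (isPolyMap_add_smul
      (mkRep (fun b k => singleSubSingle 0 1 (loopMat b k x 0 0)) ![covector x 0, 0] ![1, 0])
      (mkRep (fun b k => single 0 1 zero_ne_one (loopMat b k x 0 1)) ![0, covector x 1] 0))
    fun s => ?_
  refine quiverRep_ext (fun b k => Matrix.ext fun r q => ?_) (funext fun q => ?_)
    (funext fun r => ?_)
  · rw [loopMat_glRep_diagGL]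
    fin_cases r <;> fin_cases q <;> simp [hloop, loopMat_one_one, mul_comm]
  · rw [covector_glRep_diagGL]
    fin_cases q <;> simp [mul_comm]
  · rw [vector_glRep_diagGL, hvector]
    fin_cases r <;> simp

theorem exists_mulVec_eq_vec {v : Fin 2 → ℂ} (hv : v ≠ 0) :
    ∃ g : GL (Fin 2) ℂ, g.1 *ᵥ v = ![1, 0] := by
  obtain ⟨k, hk⟩ := Function.ne_iff.1 hv
  obtain ⟨w, hw⟩ : ∃ w : Fin 2 → ℂ, w 0 * v 0 + w 1 * v 1 = 1 := by
    refine ⟨Pi.single k (v k)⁻¹, ?_⟩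
    rw [← Fin.sum_univ_two fun r => (Pi.single k (v k)⁻¹ : Fin 2 → ℂ) r * v r]
    exact (single_dotProduct _ _ _).trans (inv_mul_cancel₀ hk)
  have hdet : !![w 0, w 1; -v 1, v 0].det ≠ 0 := by
    rw [Matrix.det_fin_two_of, mul_neg, sub_neg_eq_add, hw]
    exact one_ne_zero
  refine ⟨Matrix.GeneralLinearGroup.mkOfDetNeZero _ hdet, ?_⟩
  change !![w 0, w 1; -v 1, v 0] *ᵥ v = ![1, 0]
  ext r
  fin_cases r
  · simpa [Matrix.mulVec, dotProduct] using hw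
  · simp [Matrix.mulVec, dotProduct, mul_comm]

/-- The matrix with columns `j` and `A j`, where `A` is the loop `loop b k`. -/
def loopFrame (b : Bool) (k : Fin ℓ) (x : QuiverRep 2 ℓ) : Matrix (Fin 2) (Fin 2) ℂ :=
  (Matrix.of ![vector x, loopMat b k x *ᵥ vector x])ᵀ

theorem loopFrame_glRep (b : Bool) (k : Fin ℓ) (g : GL (Fin 2) ℂ) (x : QuiverRep 2 ℓ) :
    loopFrame b k (glRep 2 ℓ g x) = g.1 * loopFrame b k x := by
  have hloop : loopMat b k (glRep 2 ℓ g x) *ᵥ vector (glRep 2 ℓ g x) =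
      g.1 *ᵥ loopMat b k x *ᵥ vector x := by
    rw [loopMat_glRep, vector_glRep, Matrix.mulVec_mulVec, Matrix.mulVec_mulVec,
      Units.inv_mul_cancel_right]
  rw [loopFrame, hloop]
  ext r s
  fin_cases s <;> rfl

theorem isPolyMap_loopFrame (b : Bool) (k : Fin ℓ) : IsPolyMap (loopFrame b k) := by
  have hloop := isPolyMap_vec_iff.1
    ((isPolyMap_linearMap (loopMat b k)).mulVec (isPolyMap_vector (n := 2) (ℓ := ℓ)))
  refine isPolyMap_matrix_iff.2 fun r s => ?_
  fin_cases s
  exacts [isPolyMap_vec_iff.1 isPolyMap_vector r, hloop r]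

theorem loopFrame_eq_one_iff {b : Bool} {k : Fin ℓ} {x : QuiverRep 2 ℓ} :
    loopFrame b k x = 1 ↔
      vector x = ![1, 0] ∧ loopMat b k x 0 0 = 0 ∧ loopMat b k x 1 0 = 1 := by
  have hcol : vector x = ![1, 0] → loopMat b k x *ᵥ vector x = fun r => loopMat b k x r 0 := by
    rintro hx
    ext r
    simp [hx, Matrix.mulVec, dotProduct]
  rw [loopFrame, Matrix.transpose_eq_one]
  constructor
  · intro h
    have hvector : vector x = ![1, 0] := by
      rw [show vector x = (1 : Matrix (Fin 2) (Fin 2) ℂ) 0 from congrFun h 0]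
      ext r
      fin_cases r <;> rfl
    have hloop : loopMat b k x *ᵥ vector x = (1 : Matrix (Fin 2) (Fin 2) ℂ) 1 := congrFun h 1
    rw [hcol hvector] at hloop
    exact ⟨hvector, congrFun hloop 0, congrFun hloop 1⟩
  · rintro ⟨hvector, h0, h1⟩
    rw [hcol hvector, hvector]
    ext r s
    fin_cases r <;> fin_cases s <;> simp [h0, h1]

theorem det_loopFrame_of_vector_eq {b : Bool} {k : Fin ℓ} {x : QuiverRep 2 ℓ}
    (hx : vector x = ![1, 0]) : (loopFrame b k x).det = loopMat b k x 1 0 := by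
  simp [loopFrame, Matrix.det_fin_two, hx]

theorem mem_semistable_iff {x : QuiverRep 2 ℓ} :
    x ∈ semistable (glRep 2 ℓ) (detInv 2) (momentZero 2 ℓ) ↔
      x ∈ momentZero 2 ℓ ∧ ∃ b k, (loopFrame b k x).det ≠ 0 := by
  constructor
  · intro hx
    refine ⟨hx.1, ?_⟩
    by_contra! hdet
    by_cases hvector : vector x = 0
    · exact notMem_semistable_of_vector_eq_zero two_pos hvector hx
    obtain ⟨g, hg⟩ := exists_mulVec_eq_vec hvector
    refine notMem_semistable_of_upper_triangular (x := glRep 2 ℓ g x) hg (fun b k => ?_)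
      (smul_mem_semistable (fun g _ => glRep_mem_momentZero g) g hx)
    rw [← det_loopFrame_of_vector_eq hg, loopFrame_glRep, Matrix.det_mul, hdet, mul_zero]
  · rintro ⟨hx, b, k, hdet⟩
    refine ⟨hx, 1, one_pos, _, (isPolyMap_loopFrame b k).det_mem_polyFun, fun g z _ => ?_, hdet⟩
    rw [loopFrame_glRep, Matrix.det_mul, pow_one]
    exact congrArg (· * _) (congrArg Units.val (map_inv Matrix.GeneralLinearGroup.det g))

/-- The normal forms with respect to the frames `(j, A j)`, for all loops `A`. -/
def loopAtlas (ℓ : ℕ) :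
    NormalFormAtlas (glRep 2 ℓ) (detInv 2) (momentZero 2 ℓ) (Bool × Fin ℓ) where
  chart A := .ofFrame (loopFrame A.1 A.2) (isPolyMap_loopFrame A.1 A.2) (loopFrame_glRep A.1 A.2)
  smul_mem g _ := glRep_mem_momentZero g
  exists_den_ne_zero _ hx :=
    let ⟨b, k, h⟩ := (mem_semistable_iff.1 hx).2
    ⟨(b, k), h⟩

end LoopFrame

section FirstLoops

open LieAlgebra.SpecialLinear
open scoped Matrix

variable {n m : ℕ}

/-- Adds a first pair of loops `X 0 = Y 0 = 0` to a representation. -/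
def extendRep (x : QuiverRep n m) : QuiverRep n (m + 1) :=
  mkRep (fun b => Fin.cons 0 fun k => loop b k x) (covector x) (vector x)

/-- Removes the first pair of loops of a representation. -/
def tailRep (x : QuiverRep n (m + 1)) : QuiverRep n m :=
  mkRep (fun b k => loop b k.succ x) (covector x) (vector x)

@[simp] theorem loopMat_zero_extendRep (b : Bool) (x : QuiverRep n m) :
    loopMat b 0 (extendRep x) = 0 :=
  loopMat_mkRep ..

@[simp] theorem loopMat_succ_extendRep (b : Bool) (k : Fin m) (x : QuiverRep n m) :
    loopMat b k.succ (extendRep x) = loopMat b k x :=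
  loopMat_mkRep ..

@[simp] theorem vector_extendRep (x : QuiverRep n m) : vector (extendRep x) = vector x := rfl

@[simp] theorem loopMat_tailRep (b : Bool) (k : Fin m) (x : QuiverRep n (m + 1)) :
    loopMat b k (tailRep x) = loopMat b k.succ x :=
  loopMat_mkRep ..

@[simp] theorem covector_tailRep (x : QuiverRep n (m + 1)) : covector (tailRep x) = covector x :=
  rfl

@[simp] theorem vector_tailRep (x : QuiverRep n (m + 1)) : vector (tailRep x) = vector x := rfl

theorem isPolyMap_extendRep : IsPolyMap (extendRep (n := n) (m := m)) := by
  refine isPolyMap_mkRep (fun b k => ?_) isPolyMap_covector isPolyMap_vector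
  cases k using Fin.cases
  exacts [isPolyMap_const 0, isPolyMap_linearMap (loopMat b _)]

theorem isPolyMap_tailRep : IsPolyMap (tailRep (n := n) (m := m)) :=
  isPolyMap_mkRep (fun b k => isPolyMap_linearMap (loopMat b k.succ)) isPolyMap_covector
    isPolyMap_vector

theorem tailRep_extendRep (x : QuiverRep n m) : tailRep (extendRep x) = x :=
  quiverRep_ext (fun b k => by rw [loopMat_tailRep, loopMat_succ_extendRep]) rfl rfl

theorem extendRep_tailRep {x : QuiverRep n (m + 1)} (hx : ∀ b, loopMat b 0 x = 0) :
    extendRep (tailRep x) = x := by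
  refine quiverRep_ext (fun b k => ?_) rfl rfl
  cases k using Fin.cases
  · rw [loopMat_zero_extendRep, hx]
  · rw [loopMat_succ_extendRep, loopMat_tailRep]

theorem extendRep_glRep (g : GL (Fin n) ℂ) (x : QuiverRep n m) :
    extendRep (glRep n m g x) = glRep n (m + 1) g (extendRep x) := by
  refine quiverRep_ext (fun b k => ?_) rfl rfl
  cases k using Fin.cases
  · rw [loopMat_zero_extendRep, loopMat_glRep, loopMat_zero_extendRep, mul_zero, zero_mul]
  · simp only [loopMat_succ_extendRep, loopMat_glRep]

theorem momentMap_succ (x : QuiverRep n (m + 1)) :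
    momentMap n (m + 1) x =
      loopMat true 0 x * loopMat false 0 x - loopMat false 0 x * loopMat true 0 x +
        momentMap n m (tailRep x) := by
  simp only [momentMap_eq, Fin.sum_univ_succ, loopMat_tailRep, covector_tailRep, vector_tailRep,
    add_sub_assoc]

theorem momentMap_of_commute {x : QuiverRep n (m + 1)}
    (hx : ∀ k : Fin m, Commute (loopMat true k.succ x) (loopMat false k.succ x)) :
    momentMap n (m + 1) x =
      loopMat true 0 x * loopMat false 0 x - loopMat false 0 x * loopMat true 0 x -
        Matrix.vecMulVec (vector x) (covector x) := by
  rw [momentMap_eq, Fin.sum_univ_succ, Finset.sum_eq_zero fun k _ => sub_eq_zero.2 (hx k), add_zero]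

theorem commute_single_sub_single (a a' : ℂ) :
    Commute (Matrix.single 0 0 a - Matrix.single 1 1 a : Matrix (Fin 2) (Fin 2) ℂ)
      (Matrix.single 0 0 a' - Matrix.single 1 1 a') := by
  simp [Commute, SemiconjBy, sub_mul, mul_sub, mul_comm]

theorem extendRep_mem_momentZero_iff {x : QuiverRep n m} :
    extendRep x ∈ momentZero n (m + 1) ↔ x ∈ momentZero n m := by
  have h : momentMap n (m + 1) (extendRep x) = momentMap n m x := by
    rw [momentMap_succ, loopMat_zero_extendRep, loopMat_zero_extendRep, tailRep_extendRep, mul_zero,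
      sub_zero, zero_add]
  exact Eq.congr_left h

theorem loopFrame_extendRep_succ (b : Bool) (k : Fin m) (x : QuiverRep 2 m) :
    loopFrame b k.succ (extendRep x) = loopFrame b k x := by
  rw [loopFrame, loopMat_succ_extendRep, vector_extendRep, loopFrame]

theorem det_loopFrame_extendRep_zero (b : Bool) (x : QuiverRep 2 m) :
    (loopFrame b 0 (extendRep x)).det = 0 := by
  rw [loopFrame, loopMat_zero_extendRep, Matrix.zero_mulVec, Matrix.det_transpose]
  exact Matrix.det_eq_zero_of_row_eq_zero 1 fun _ => rfl

theorem extendRep_mem_semistable_iff {x : QuiverRep 2 m} :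
    extendRep x ∈ semistable (glRep 2 (m + 1)) (detInv 2) (momentZero 2 (m + 1)) ↔
      x ∈ semistable (glRep 2 m) (detInv 2) (momentZero 2 m) := by
  simp only [mem_semistable_iff, extendRep_mem_momentZero_iff, Fin.exists_fin_succ,
    det_loopFrame_extendRep_zero, loopFrame_extendRep_succ, ne_eq, not_true_eq_false, false_or]

/-- The representations in normal form with respect to the frame `(j, A j)`, `A = loop b 0`, which
are fixed by the torus rescaling the first loops: `A` is the elementary matrix `e₂₁`, the other
first loop and `i` vanish, and the remaining loops are diagonal. -/
def chartRep (b : Bool) (c : Bool → Fin m → ℂ) : QuiverRep 2 (m + 1) :=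
  mkRep (fun b' => Fin.cons (if b' = b then single 1 0 one_ne_zero 1 else 0)
    fun k => singleSubSingle 0 1 (c b' k)) 0 ![1, 0]

theorem loopMat_zero_chartRep_self (b : Bool) (c : Bool → Fin m → ℂ) :
    loopMat b 0 (chartRep b c) = Matrix.single 1 0 1 := by
  simp [chartRep]

theorem loopMat_zero_chartRep_of_ne {b b' : Bool} (h : b' ≠ b) (c : Bool → Fin m → ℂ) :
    loopMat b' 0 (chartRep b c) = 0 := by
  simp [chartRep, h]

theorem loopMat_succ_chartRep (b b' : Bool) (k : Fin m) (c : Bool → Fin m → ℂ) :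
    loopMat b' k.succ (chartRep b c) = Matrix.single 0 0 (c b' k) - Matrix.single 1 1 (c b' k) := by
  simp [chartRep]

@[simp] theorem covector_chartRep (b : Bool) (c : Bool → Fin m → ℂ) :
    covector (chartRep b c) = 0 := rfl

@[simp] theorem vector_chartRep (b : Bool) (c : Bool → Fin m → ℂ) :
    vector (chartRep b c) = ![1, 0] := rfl

theorem isPolyMap_chartRep (b : Bool) : IsPolyMap (chartRep (m := m) b) := by
  refine isPolyMap_mkRep (fun b' k => ?_) (isPolyMap_const _) (isPolyMap_const _)
  cases k using Fin.cases with
  | zero => exact isPolyMap_const (slIncl 2 (if b' = b then single 1 0 one_ne_zero 1 else 0))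
  | succ k =>
    have hcoord : IsPolyMap fun c : Bool → Fin m → ℂ => c b' k :=
      isPolyMap_pi_iff.1 (isPolyMap_pi_iff.1 (isPolyMap_linearMap LinearMap.id) b') k
    exact (isPolyMap_linearMap (slIncl 2 ∘ₗ singleSubSingle 0 1)).comp hcoord

theorem chartRep_mem_momentZero (b : Bool) (c : Bool → Fin m → ℂ) :
    chartRep b c ∈ momentZero 2 (m + 1) := by
  change momentMap 2 (m + 1) (chartRep b c) = 0
  rw [momentMap_of_commute fun k => ?_, covector_chartRep, Matrix.vecMulVec_zero, sub_zero]
  · cases b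
    · rw [loopMat_zero_chartRep_of_ne (b' := true) (by decide), zero_mul, mul_zero, sub_zero]
    · rw [loopMat_zero_chartRep_of_ne (b' := false) (by decide), zero_mul, mul_zero, sub_zero]
  · rw [loopMat_succ_chartRep, loopMat_succ_chartRep]
    exact commute_single_sub_single _ _

theorem loopFrame_chartRep_self (b : Bool) (c : Bool → Fin m → ℂ) :
    loopFrame b 0 (chartRep b c) = 1 :=
  loopFrame_eq_one_iff.2 (by simp [loopMat_zero_chartRep_self])

theorem det_loopFrame_chartRep_self (b : Bool) (c : Bool → Fin m → ℂ) :
    (loopFrame b 0 (chartRep b c)).det = 1 := by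
  rw [loopFrame_chartRep_self, Matrix.det_one]

theorem det_loopFrame_chartRep_of_ne {b b' : Bool} (h : b' ≠ b) (c : Bool → Fin m → ℂ) :
    (loopFrame b' 0 (chartRep b c)).det = 0 := by
  rw [det_loopFrame_of_vector_eq (vector_chartRep b c), loopMat_zero_chartRep_of_ne h]
  rfl

theorem chartRep_mem_semistable (b : Bool) (c : Bool → Fin m → ℂ) :
    chartRep b c ∈ semistable (glRep 2 (m + 1)) (detInv 2) (momentZero 2 (m + 1)) :=
  mem_semistable_iff.2
    ⟨chartRep_mem_momentZero b c, b, 0, (det_loopFrame_chartRep_self b c).trans_ne one_ne_zero⟩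

/-- The coordinates on the fixed points in normal form with respect to a first loop: the first
diagonal entries of the remaining loops. -/
def chartCoord (x : QuiverRep 2 (m + 1)) (b : Bool) (k : Fin m) : ℂ := loopMat b k.succ x 0 0

theorem isPolyMap_chartCoord : IsPolyMap (chartCoord (m := m)) :=
  isPolyMap_pi_iff.2 fun b => isPolyMap_vec_iff.2 fun k =>
    isPolyMap_matrix_iff.1 (isPolyMap_linearMap (loopMat b k.succ)) 0 0

theorem chartCoord_chartRep (b : Bool) (c : Bool → Fin m → ℂ) :
    chartCoord (chartRep b c) = c := by
  funext b' k
  simp [chartCoord, loopMat_succ_chartRep]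

end FirstLoops

section Torus

open scoped Matrix

variable {n ℓ m : ℕ}

/-- The weight of the torus on the loop `loop b k`. -/
def torusWeight (t : Fin ℓ → ℂˣ) (b : Bool) (k : Fin ℓ) : ℂˣ := bif b then t k else (t k)⁻¹

theorem loopMat_torusRep (t : Fin ℓ → ℂˣ) (b : Bool) (k : Fin ℓ) (x : QuiverRep n ℓ) :
    loopMat b k (torusRep n ℓ t x) = (torusWeight t b k : ℂ) • loopMat b k x := by
  cases b <;> rfl

theorem vector_torusRep (t : Fin ℓ → ℂˣ) (x : QuiverRep n ℓ) :
    vector (torusRep n ℓ t x) = vector x := rfl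

theorem torusWeight_not (t : Fin ℓ → ℂˣ) (b : Bool) (k : Fin ℓ) :
    torusWeight t (!b) k = (torusWeight t b k)⁻¹ := by
  cases b
  exacts [(inv_inv _).symm, rfl]

theorem torusWeight_eq_one {t : Fin ℓ → ℂˣ} {k : Fin ℓ} (h : t k = 1) (b : Bool) :
    torusWeight t b k = 1 := by
  cases b <;> simp [torusWeight, h]

theorem torusWeight_sq_ne_one {t : Fin ℓ → ℂˣ} {k : Fin ℓ} (h : t k ^ 2 ≠ 1) (b : Bool) :
    torusWeight t b k ^ 2 ≠ 1 := by
  cases b <;> simpa [torusWeight] using h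

theorem torusRep_eq_glRep_diagGL_iff {t : Fin ℓ → ℂˣ} {v : Fin n → ℂˣ} {x : QuiverRep n ℓ} :
    torusRep n ℓ t x = glRep n ℓ (diagGL v) x ↔
      (∀ b k r s, torusWeight t b k * v s = v r ∨ loopMat b k x r s = 0) ∧
        (∀ s, v s = 1 ∨ covector x s = 0) ∧ ∀ r, v r = 1 ∨ vector x r = 0 := by
  have hentries : torusRep n ℓ t x = glRep n ℓ (diagGL v) x ↔
      (∀ b k r s, (torusWeight t b k : ℂ) * loopMat b k x r s =
        v r * loopMat b k x r s * ((v s)⁻¹ : ℂˣ)) ∧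
      (∀ s, covector x s = covector x s * ((v s)⁻¹ : ℂˣ)) ∧ ∀ r, vector x r = v r * vector x r := by
    simp only [← loopMat_glRep_diagGL, ← covector_glRep_diagGL, ← vector_glRep_diagGL]
    constructor
    · intro h
      rw [← h]
      exact ⟨fun b k r s => by rw [loopMat_torusRep]; rfl, fun _ => rfl, fun _ => rfl⟩
    · rintro ⟨hloop, hcovector, hvector⟩
      refine quiverRep_ext (fun b k => ?_) (funext hcovector) (funext hvector)
      rw [loopMat_torusRep]
      exact Matrix.ext (hloop b k)
  have hweight (a : ℂ) (u u' w : ℂˣ) : w * a = u' * a * (u⁻¹ : ℂˣ) ↔ w * u = u' ∨ a = 0 := by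
    rw [Units.eq_mul_inv_iff_mul_eq, mul_right_comm, mul_eq_mul_right_iff, Units.ext_iff,
      Units.val_mul]
  have hcovector (a : ℂ) (u : ℂˣ) : a = a * (u⁻¹ : ℂˣ) ↔ u = 1 ∨ a = 0 := by
    simpa [eq_comm] using hweight a u 1 1
  have hvector (a : ℂ) (u : ℂˣ) : a = u * a ↔ u = 1 ∨ a = 0 := by
    simpa [eq_comm] using hweight a 1 u 1
  simp only [hentries, hweight, hcovector, hvector]

theorem loopFrame_torusRep (t : Fin ℓ → ℂˣ) (b : Bool) (k : Fin ℓ) (x : QuiverRep 2 ℓ) :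
    loopFrame b k (torusRep 2 ℓ t x) = loopFrame b k x * (diagGL ![1, torusWeight t b k]).1 := by
  rw [loopFrame, loopMat_torusRep, vector_torusRep, Matrix.smul_mulVec]
  ext r s
  refine Eq.trans ?_ (Matrix.mul_diagonal ..).symm
  fin_cases s
  exacts [(mul_one _).symm, mul_comm _ _]

/-- The basis `(j, A j)` is rescaled by `(1, w)`, where `w` is the weight of the loop `A`. -/
theorem eq_diagGL_of_torusRep_eq {t : Fin ℓ → ℂˣ} {b : Bool} {k : Fin ℓ} {x : QuiverRep 2 ℓ}
    {g : GL (Fin 2) ℂ} (hx : loopFrame b k x = 1) (hg : torusRep 2 ℓ t x = glRep 2 ℓ g x) :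
    g = diagGL ![1, torusWeight t b k] := by
  refine Units.ext ?_
  rw [← mul_one g.1, ← hx, ← loopFrame_glRep, ← hg, loopFrame_torusRep, hx, one_mul]

theorem torusAct_gitMk_eq_iff {t : Fin ℓ → ℂˣ} {x : QuiverRep 2 ℓ}
    {hx : x ∈ semistable (glRep 2 ℓ) (detInv 2) (momentZero 2 ℓ)} :
    torusAct 2 ℓ t (gitMk x hx) = gitMk x hx ↔ ∃ g, torusRep 2 ℓ t x = glRep 2 ℓ g x :=
  eq_comm.trans ((loopAtlas ℓ).gitMk_eq_gitMk_iff (hy := semistable_map _ _ _ _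
    (torusRep_comm 2 ℓ) (torusRep_momentZero 2 ℓ) t hx))

theorem torusRep_extendRep {t : Fin (m + 1) → ℂˣ} (ht : ∀ k : Fin m, t k.succ = 1)
    (x : QuiverRep n m) : torusRep n (m + 1) t (extendRep x) = extendRep x := by
  refine quiverRep_ext (fun b k => ?_) rfl rfl
  rw [loopMat_torusRep]
  cases k using Fin.cases with
  | zero => rw [loopMat_zero_extendRep, smul_zero]
  | succ k => rw [torusWeight_eq_one (ht k), Units.val_one, one_smul]

theorem torusRep_chartRep {t : Fin (m + 1) → ℂˣ} (ht : ∀ k : Fin m, t k.succ = 1) (b : Bool)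
    (c : Bool → Fin m → ℂ) :
    torusRep 2 (m + 1) t (chartRep b c) =
      glRep 2 (m + 1) (diagGL ![1, torusWeight t b 0]) (chartRep b c) := by
  refine torusRep_eq_glRep_diagGL_iff.2 ⟨fun b' k r s => ?_, fun s => .inr rfl, ?_⟩
  · cases k using Fin.cases with
    | zero =>
      obtain rfl | hb := eq_or_ne b' b
      · rw [loopMat_zero_chartRep_self]
        fin_cases r <;> fin_cases s <;> simp
      · exact .inr (by rw [loopMat_zero_chartRep_of_ne hb]; rfl)
    | succ k =>
      rw [torusWeight_eq_one (ht k), loopMat_succ_chartRep]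
      fin_cases r <;> fin_cases s <;> simp
  · exact Fin.forall_fin_two.2 ⟨.inl rfl, .inr rfl⟩

section FixedNormalForm

variable {t : Fin (m + 1) → ℂˣ} {b : Bool} {x : QuiverRep 2 (m + 1)} {g : GL (Fin 2) ℂ}

theorem loopMat_zero_eq_zero_of_fixed (ht₀ : t 0 ^ 2 ≠ 1) (ht : ∀ k : Fin m, t k.succ = 1)
    {k : Fin m} (hx : loopFrame b k.succ x = 1)
    (hg : torusRep 2 (m + 1) t x = glRep 2 (m + 1) g x) (b' : Bool) : loopMat b' 0 x = 0 := by
  obtain rfl := eq_diagGL_of_torusRep_eq hx hg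
  obtain ⟨hloop, -, -⟩ := torusRep_eq_glRep_diagGL_iff.1 hg
  have hv : ∀ r, (![1, torusWeight t b k.succ] : Fin 2 → ℂˣ) r = 1 :=
    Fin.forall_fin_two.2 ⟨rfl, torusWeight_eq_one (ht k) b⟩
  ext r s
  refine (hloop b' 0 r s).resolve_left fun h => torusWeight_sq_ne_one ht₀ b' ?_
  rw [hv, hv, mul_one] at h
  rw [h, one_pow]

theorem loopMat_eq_single_sub_single (b' : Bool) (k : Fin (m + 1)) (h01 : loopMat b' k x 0 1 = 0)
    (h10 : loopMat b' k x 1 0 = 0) :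
    loopMat b' k x =
      Matrix.single 0 0 (loopMat b' k x 0 0) - Matrix.single 1 1 (loopMat b' k x 0 0) := by
  ext r s
  fin_cases r <;> fin_cases s <;> simp [h01, h10, loopMat_one_one]

theorem eq_zero_of_mem_momentZero (hx : x ∈ momentZero 2 (m + 1)) {u : ℂ}
    (hself : loopMat b 0 x = Matrix.single 1 0 1) (hother : loopMat (!b) 0 x = Matrix.single 0 1 u)
    (hsucc : ∀ b' k, loopMat b' k.succ x =
      Matrix.single 0 0 (chartCoord x b' k) - Matrix.single 1 1 (chartCoord x b' k))
    (hvector : vector x = ![1, 0]) : u = 0 ∧ covector x 0 = 0 := by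
  have hmoment := momentMap_of_commute (x := x) fun k => by
    rw [hsucc, hsucc]
    exact commute_single_sub_single _ _
  rw [show momentMap 2 (m + 1) x = 0 from hx] at hmoment
  have hentry (r : Fin 2) : (0 : ℂ) =
      (loopMat true 0 x * loopMat false 0 x - loopMat false 0 x * loopMat true 0 x) r r -
        vector x r * covector x r :=
    congrFun (congrFun hmoment r) r
  have hu : u = 0 := by
    have h11 := hentry 1
    cases b <;> simp only [Bool.not_false, Bool.not_true] at hother <;>
      simpa [hself, hother, hvector, eq_comm] using h11
  have h00 := hentry 0
  refine ⟨hu, ?_⟩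
  cases b <;> simp only [Bool.not_false, Bool.not_true] at hother <;>
    simpa [hself, hother, hvector, hu] using h00

theorem eq_chartRep_of_fixed (ht₀ : t 0 ^ 2 ≠ 1) (ht : ∀ k : Fin m, t k.succ = 1)
    (hx : x ∈ momentZero 2 (m + 1)) (hframe : loopFrame b 0 x = 1)
    (hg : torusRep 2 (m + 1) t x = glRep 2 (m + 1) g x) : x = chartRep b (chartCoord x) := by
  obtain rfl := eq_diagGL_of_torusRep_eq hframe hg
  obtain ⟨hloop, hcovector, -⟩ := torusRep_eq_glRep_diagGL_iff.1 hg
  obtain ⟨hvector, h00, h10⟩ := loopFrame_eq_one_iff.1 hframe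
  have hw2 := torusWeight_sq_ne_one ht₀ b
  have hw1 : torusWeight t b 0 ≠ 1 := fun h => hw2 (by rw [h, one_pow])
  have hself : loopMat b 0 x = Matrix.single 1 0 1 := by
    have h01 := (hloop b 0 0 1).resolve_left fun h => hw2 ((sq _).trans h)
    ext r s
    fin_cases r <;> fin_cases s <;> simp [h00, h01, h10, loopMat_one_one]
  have hother : loopMat (!b) 0 x = Matrix.single 0 1 (loopMat (!b) 0 x 0 1) := by
    have h00 := (hloop (!b) 0 0 0).resolve_left fun h => hw1 <| by
      rwa [torusWeight_not, mul_eq_right, inv_eq_one] at h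
    have h10 := (hloop (!b) 0 1 0).resolve_left fun h => hw2 <| by
      have hinv : (torusWeight t b 0)⁻¹ * 1 = torusWeight t b 0 := torusWeight_not t b 0 ▸ h
      rwa [mul_one, inv_eq_iff_mul_eq_one, ← sq] at hinv
    ext r s
    fin_cases r <;> fin_cases s <;> simp [h00, h10, loopMat_one_one]
  have hsucc (b' : Bool) (k : Fin m) : loopMat b' k.succ x =
      Matrix.single 0 0 (chartCoord x b' k) - Matrix.single 1 1 (chartCoord x b' k) := by
    have h01 := (hloop b' k.succ 0 1).resolve_left fun h => hw1 <| by
      rwa [torusWeight_eq_one (ht k), one_mul] at h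
    have h10 := (hloop b' k.succ 1 0).resolve_left fun h => hw1 <| by
      rw [torusWeight_eq_one (ht k), one_mul] at h
      exact h.symm
    exact loopMat_eq_single_sub_single b' k.succ h01 h10
  obtain ⟨hu, h0⟩ := eq_zero_of_mem_momentZero hx hself hother hsucc hvector
  rw [hu, Matrix.single_zero] at hother
  refine quiverRep_ext (fun b' k => ?_) ?_ hvector
  · cases k using Fin.cases with
    | zero =>
      obtain rfl | hb := eq_or_ne b' b
      · rw [hself, loopMat_zero_chartRep_self]
      · rw [loopMat_zero_chartRep_of_ne hb, Bool.eq_not.2 hb, hother]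
    | succ k => rw [hsucc, loopMat_succ_chartRep]
  · exact funext (Fin.forall_fin_two.2 ⟨h0, (hcovector 1).resolve_left hw1⟩)

end FixedNormalForm

end Torus

section Decomposition

open FunctionSpace

variable {m : ℕ} {E : Type} [AddCommGroup E] [Module ℂ E]

/-- The map of quiver varieties adding a first pair of loops `X 0 = Y 0 = 0`. -/
def extendMap : (quiverVariety 2 m).carrier → (quiverVariety 2 (m + 1)).carrier :=
  gitMap extendRep isPolyMap_extendRep extendRep_glRep fun _ => extendRep_mem_semistable_iff.2

/-- The affine space of classes of the representations `chartRep b c`. -/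
def chartMap (b : Bool) (c : Bool → Fin m → ℂ) : (quiverVariety 2 (m + 1)).carrier :=
  gitMk (chartRep b c) (chartRep_mem_semistable b c)

theorem isMor_extendMap :
    IsMor (quiverVariety 2 m) (quiverVariety 2 (m + 1)) (extendMap (m := m)) :=
  isMor_gitMap isPolyMap_extendRep extendRep_glRep fun _ => extendRep_mem_semistable_iff.2

theorem isMor_chartMap (b : Bool) :
    IsMor (affineSpace (Bool → Fin m → ℂ)) (quiverVariety 2 (m + 1)) (chartMap b) :=
  (isMor_mk _).comp fun c => MorAt.codRestrict ((isPolyMap_chartRep b).isMor c)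

theorem extendMap_injective : Function.Injective (extendMap (m := m)) := by
  intro p q h
  obtain ⟨x, hx, rfl⟩ := exists_gitMk_eq p
  obtain ⟨y, hy, rfl⟩ := exists_gitMk_eq q
  obtain ⟨g, hg⟩ := (loopAtlas (m + 1)).gitMk_eq_gitMk_iff.1 h
  rw [← extendRep_glRep] at hg
  exact (loopAtlas m).gitMk_eq_gitMk_iff.2
    ⟨g, (Function.LeftInverse.injective tailRep_extendRep) hg⟩

theorem extendMap_notMem_locus_zero (b : Bool) (p : (quiverVariety 2 m).carrier) :
    extendMap p ∉ (loopAtlas (m + 1)).locus (b, 0) := by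
  obtain ⟨x, hx, rfl⟩ := exists_gitMk_eq p
  exact fun h => (loopAtlas (m + 1)).gitMk_mem_locus_iff.1 h (det_loopFrame_extendRep_zero b x)

theorem chartMap_mem_locus_zero_iff {b b' : Bool} {c : Bool → Fin m → ℂ} :
    chartMap b c ∈ (loopAtlas (m + 1)).locus (b', 0) ↔ b' = b := by
  refine (loopAtlas (m + 1)).gitMk_mem_locus_iff.trans ⟨fun h => ?_, ?_⟩
  · by_contra hb
    exact h (det_loopFrame_chartRep_of_ne hb c)
  · rintro rfl
    exact (det_loopFrame_chartRep_self b' c).trans_ne one_ne_zero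

theorem normalForm_chartMap (b : Bool) (c : Bool → Fin m → ℂ) :
    (loopAtlas (m + 1)).normalForm (b, 0) (chartMap b c) = chartRep b c :=
  RationalNormalForm.eval_of_frame_eq_one _ (isPolyMap_loopFrame b 0) (loopFrame_glRep b 0)
    (loopFrame_chartRep_self b c)

theorem chartMap_injective (b : Bool) : Function.Injective (chartMap (m := m) b) := by
  refine Function.LeftInverse.injective
    (g := fun p => chartCoord ((loopAtlas (m + 1)).normalForm (b, 0) p)) fun c => ?_
  change chartCoord ((loopAtlas (m + 1)).normalForm (b, 0) (chartMap b c)) = c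
  rw [normalForm_chartMap, chartCoord_chartRep]

/-- The pieces of the fixed locus, with linear coordinates `e` on the last two. -/
def fixedParam (e : E ≃ₗ[ℂ] (Bool → Fin m → ℂ)) :
    (quiverVariety 2 m).carrier ⊕ (E ⊕ E) → (quiverVariety 2 (m + 1)).carrier :=
  Sum.elim extendMap (Sum.elim (fun v => chartMap true (e v)) fun v => chartMap false (e v))

theorem isMor_fixedParam (e : E ≃ₗ[ℂ] (Bool → Fin m → ℂ)) :
    IsMor ((quiverVariety 2 m).coprod ((affineSpace E).coprod (affineSpace E)))
      (quiverVariety 2 (m + 1)) (fixedParam (E := E) e) := by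
  have he : IsPolyMap e := isPolyMap_linearMap e.toLinearMap
  have hchart (b : Bool) :
      IsMor (affineSpace E) (quiverVariety 2 (m + 1)) fun v => chartMap b (e v) :=
    (isMor_chartMap b).comp he.isMor
  exact isMor_sumElim isMor_extendMap (isMor_sumElim (hchart true) (hchart false))

theorem fixedParam_injective (e : E ≃ₗ[ℂ] (Bool → Fin m → ℂ)) :
    Function.Injective (fixedParam e) := by
  have hextend (p : (quiverVariety 2 m).carrier) (b : Bool) (v : E) :
      extendMap p ≠ chartMap b (e v) := fun h =>
    extendMap_notMem_locus_zero b p (h ▸ chartMap_mem_locus_zero_iff.2 rfl)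
  have hchart (v v' : E) : chartMap true (e v) ≠ chartMap false (e v') := fun h => by
    have hmem : chartMap false (e v') ∈ (loopAtlas (m + 1)).locus (false, 0) :=
      chartMap_mem_locus_zero_iff.2 rfl
    rw [← h] at hmem
    exact Bool.false_ne_true (chartMap_mem_locus_zero_iff.1 hmem)
  refine extendMap_injective.sumElim (.sumElim ?_ ?_ hchart) ?_
  · exact (chartMap_injective true).comp e.injective
  · exact (chartMap_injective false).comp e.injective
  · rintro p (v | v)
    exacts [hextend p true v, hextend p false v]

/-- The inclusion of the piece `chartMap b`. -/
def affineIncl (b : Bool) (v : E) : (quiverVariety 2 m).carrier ⊕ (E ⊕ E) :=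
  .inr (bif b then .inl v else .inr v)

theorem fixedParam_affineIncl (e : E ≃ₗ[ℂ] (Bool → Fin m → ℂ)) (b : Bool) (v : E) :
    fixedParam e (affineIncl b v) = chartMap b (e v) := by
  cases b <;> rfl

theorem isMor_affineIncl (b : Bool) :
    IsMor (affineSpace E) ((quiverVariety 2 m).coprod ((affineSpace E).coprod (affineSpace E)))
      (affineIncl b) := by
  cases b
  exacts [isMor_inr.comp isMor_inr, isMor_inr.comp isMor_inl]

section Fixed

variable {t : Fin (m + 1) → ℂˣ}

theorem torusAct_fixedParam (ht : ∀ k : Fin m, t k.succ = 1) (e : E ≃ₗ[ℂ] (Bool → Fin m → ℂ))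
    (y : (quiverVariety 2 m).carrier ⊕ (E ⊕ E)) :
    torusAct 2 (m + 1) t (fixedParam e y) = fixedParam e y := by
  have hchart (b : Bool) (c : Bool → Fin m → ℂ) :
      torusAct 2 (m + 1) t (chartMap b c) = chartMap b c :=
    torusAct_gitMk_eq_iff.2 ⟨_, torusRep_chartRep ht b c⟩
  obtain p | v | v := y
  · obtain ⟨x, hx, rfl⟩ := exists_gitMk_eq p
    exact torusAct_gitMk_eq_iff.2 ⟨1, by rw [torusRep_extendRep ht, map_one]; rfl⟩
  · exact hchart true (e v)
  · exact hchart false (e v)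

theorem loopFrame_normalForm {ℓ : ℕ} {b : Bool} {k : Fin ℓ} {p : (quiverVariety 2 ℓ).carrier}
    (hp : p ∈ (loopAtlas ℓ).locus (b, k)) :
    loopFrame b k ((loopAtlas ℓ).normalForm (b, k) p) = 1 := by
  obtain ⟨x, hx, rfl⟩ := exists_gitMk_eq p
  rw [NormalFormAtlas.normalForm_gitMk]
  exact RationalNormalForm.frame_eval _ (isPolyMap_loopFrame b k) (loopFrame_glRep b k) hp

theorem exists_torusRep_normalForm_eq {ℓ : ℕ} {t : Fin ℓ → ℂˣ} {i : Bool × Fin ℓ}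
    {p : (quiverVariety 2 ℓ).carrier} (hp : p ∈ (loopAtlas ℓ).locus i)
    (hfixed : torusAct 2 ℓ t p = p) :
    ∃ g, torusRep 2 ℓ t ((loopAtlas ℓ).normalForm i p) =
      glRep 2 ℓ g ((loopAtlas ℓ).normalForm i p) := by
  obtain ⟨hss, hmk⟩ := (loopAtlas ℓ).exists_gitMk_normalForm hp
  rw [← hmk] at hfixed
  exact torusAct_gitMk_eq_iff.1 hfixed

theorem chartMap_chartCoord_normalForm (ht₀ : t 0 ^ 2 ≠ 1) (ht : ∀ k : Fin m, t k.succ = 1)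
    {b : Bool} {p : (quiverVariety 2 (m + 1)).carrier}
    (hp : p ∈ (loopAtlas (m + 1)).locus (b, 0)) (hfixed : torusAct 2 (m + 1) t p = p) :
    chartMap b (chartCoord ((loopAtlas (m + 1)).normalForm (b, 0) p)) = p := by
  obtain ⟨hss, hmk⟩ := (loopAtlas (m + 1)).exists_gitMk_normalForm hp
  obtain ⟨g, hg⟩ := exists_torusRep_normalForm_eq hp hfixed
  have hchart := eq_chartRep_of_fixed ht₀ ht hss.1 (loopFrame_normalForm hp) hg
  refine Eq.trans ?_ hmk
  unfold chartMap
  congr 1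
  exact hchart.symm

theorem exists_extendMap_gitMk_tailRep (ht₀ : t 0 ^ 2 ≠ 1) (ht : ∀ k : Fin m, t k.succ = 1)
    {b : Bool} {k : Fin m} {p : (quiverVariety 2 (m + 1)).carrier}
    (hp : p ∈ (loopAtlas (m + 1)).locus (b, k.succ)) (hfixed : torusAct 2 (m + 1) t p = p) :
    ∃ hss, extendMap (gitMk (tailRep ((loopAtlas (m + 1)).normalForm (b, k.succ) p)) hss) = p := by
  obtain ⟨hss, hmk⟩ := (loopAtlas (m + 1)).exists_gitMk_normalForm hp
  obtain ⟨g, hg⟩ := exists_torusRep_normalForm_eq hp hfixed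
  have hextend := extendRep_tailRep
    (loopMat_zero_eq_zero_of_fixed ht₀ ht (loopFrame_normalForm hp) hg)
  refine ⟨extendRep_mem_semistable_iff.1 (hextend.symm ▸ hss), Eq.trans ?_ hmk⟩
  exact (loopAtlas (m + 1)).gitMk_eq_gitMk_iff.2 ⟨1, by rw [hextend, map_one]; rfl⟩

theorem eventually_mem_locus {ℓ : ℕ} {i : Bool × Fin ℓ} {S : Set (quiverVariety 2 ℓ).carrier}
    {p : ((quiverVariety 2 ℓ).induced S).carrier} (hp : p.1 ∈ (loopAtlas ℓ).locus i) :
    ∀ᶠ q in 𝓝 p, q.1 ∈ (loopAtlas ℓ).locus i :=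
  (isMor_val S).continuous.continuousAt.eventually_mem
    (((loopAtlas ℓ).isOpen_locus i).mem_nhds hp)

theorem exists_section_of_mem_locus_zero (ht₀ : t 0 ^ 2 ≠ 1) (ht : ∀ k : Fin m, t k.succ = 1)
    (e : E ≃ₗ[ℂ] (Bool → Fin m → ℂ)) {S : Set (quiverVariety 2 (m + 1)).carrier}
    (hS : ∀ p ∈ S, torusAct 2 (m + 1) t p = p) {b : Bool}
    {p : ((quiverVariety 2 (m + 1)).induced S).carrier}
    (hp : p.1 ∈ (loopAtlas (m + 1)).locus (b, 0)) :
    ∃ s, MorAt ((quiverVariety 2 (m + 1)).induced S)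
        ((quiverVariety 2 m).coprod ((affineSpace E).coprod (affineSpace E))) s p ∧
      ∀ᶠ q in 𝓝 p, fixedParam e (s q) = q.1 := by
  have hcoord : IsPolyMap fun x : QuiverRep 2 (m + 1) => e.symm (chartCoord x) :=
    (isPolyMap_linearMap e.symm.toLinearMap).comp isPolyMap_chartCoord
  have hnormal := ((loopAtlas (m + 1)).morAt_normalForm hp).comp (isMor_val S p)
  refine ⟨_, (isMor_affineIncl b _).comp ((hcoord.isMor _).comp hnormal), ?_⟩
  filter_upwards [eventually_mem_locus hp] with q hq
  exact (fixedParam_affineIncl e b _).trans <| (congrArg _ (e.apply_symm_apply _)).trans <|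
    chartMap_chartCoord_normalForm ht₀ ht hq (hS q.1 q.2)

theorem exists_section_of_mem_locus_succ (ht₀ : t 0 ^ 2 ≠ 1) (ht : ∀ k : Fin m, t k.succ = 1)
    (e : E ≃ₗ[ℂ] (Bool → Fin m → ℂ)) {S : Set (quiverVariety 2 (m + 1)).carrier}
    (hS : ∀ p ∈ S, torusAct 2 (m + 1) t p = p) {b : Bool} {k : Fin m}
    {p : ((quiverVariety 2 (m + 1)).induced S).carrier}
    (hp : p.1 ∈ (loopAtlas (m + 1)).locus (b, k.succ)) :
    ∃ s, MorAt ((quiverVariety 2 (m + 1)).induced S)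
        ((quiverVariety 2 m).coprod ((affineSpace E).coprod (affineSpace E))) s p ∧
      ∀ᶠ q in 𝓝 p, fixedParam e (s q) = q.1 := by
  have hnormal := ((loopAtlas (m + 1)).morAt_normalForm hp).comp (isMor_val S p)
  have hgitMk : ∀ᶠ q in 𝓝 p, ∃ hss, extendMap
      (gitMk (tailRep ((loopAtlas (m + 1)).normalForm (b, k.succ) q.1)) hss) = q.1 := by
    filter_upwards [eventually_mem_locus hp] with q hq
    exact exists_extendMap_gitMk_tailRep ht₀ ht hq (hS q.1 q.2)
  obtain ⟨s, hs, hsq⟩ := exists_morAt_gitMk ((isPolyMap_tailRep.isMor _).comp hnormal)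
    (hgitMk.mono fun _ ⟨hss, _⟩ => hss)
  refine ⟨_, (isMor_inl _).comp hs, ?_⟩
  filter_upwards [hgitMk, hsq] with q ⟨_, hq⟩ ⟨_, hsq⟩
  exact (congrArg extendMap hsq).trans hq

theorem exists_section_fixedParam (ht₀ : t 0 ^ 2 ≠ 1) (ht : ∀ k : Fin m, t k.succ = 1)
    (e : E ≃ₗ[ℂ] (Bool → Fin m → ℂ)) {S : Set (quiverVariety 2 (m + 1)).carrier}
    (hS : ∀ p ∈ S, torusAct 2 (m + 1) t p = p) (p : ((quiverVariety 2 (m + 1)).induced S).carrier) :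
    ∃ s, MorAt ((quiverVariety 2 (m + 1)).induced S)
        ((quiverVariety 2 m).coprod ((affineSpace E).coprod (affineSpace E))) s p ∧
      ∀ᶠ q in 𝓝 p, fixedParam e (s q) = q.1 := by
  obtain ⟨⟨b, k⟩, hp⟩ := (loopAtlas (m + 1)).exists_mem_locus p.1
  cases k using Fin.cases with
  | zero => exact exists_section_of_mem_locus_zero ht₀ ht e hS hp
  | succ k => exact exists_section_of_mem_locus_succ ht₀ ht e hS hp

end Fixed

end Decomposition

theorem mainTheorem12 (ℓ d : ℕ) (hℓ : 1 ≤ ℓ) (hd : 0 < d) :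
    Nonempty (FunctionSpace.Iso (fixedLocus 2 ℓ (nuTilde ℓ d))
      ((quiverVariety 2 (ℓ - 1)).coprod
        ((affineSpace (Fin (2 * ℓ - 2) → ℂ)).coprod (affineSpace (Fin (2 * ℓ - 2) → ℂ))))) := by
  obtain ⟨m, rfl⟩ := Nat.exists_eq_add_of_le' hℓ
  have e : (Fin (2 * (m + 1) - 2) → ℂ) ≃ₗ[ℂ] (Bool → Fin m → ℂ) :=
    LinearEquiv.ofFinrankEq _ _ (by simp [Module.finrank_pi_fintype, Nat.mul_add])
  have hsucc (s : ℂˣ) (k : Fin m) : nuTilde (m + 1) d s k.succ = 1 := by simp [nuTilde]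
  obtain ⟨z, hz⟩ := IsAlgClosed.exists_pow_nat_eq (2 : ℂ) hd
  have hz0 : z ≠ 0 := by
    rintro rfl
    simp [hd.ne'] at hz
  have hzero : nuTilde (m + 1) d (Units.mk0 z hz0) 0 ^ 2 ≠ 1 := by
    norm_num [nuTilde, Units.ext_iff, hz]
  refine FunctionSpace.Iso.nonempty_of_local_sections (isMor_fixedParam e) (fixedParam_injective e)
    (fun y s => torusAct_fixedParam (hsucc s) e y) ?_
  exact exists_section_fixedParam hzero (hsucc _) e fun _ (hp : ∀ s, _) => hp _
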